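/- All algebras are over $\mathbb{Q}$ and graded, and tensor products of graded algebras carry the Koszul sign rule $(a\otimes b)(a'\otimes b')=(-1)^{\deg b\,\deg a'}aa'\otimes bb'$. Let $s\ge 2$, $n\ge1$, $g\ge1$ be integers. The rational cohomology algebra $H^*(\Sigma_g)$ of the closed orientable surface of genus $g$ has basis $1$ (degree $0$), $a(p),b(p)$ for $1\le p\le g$ (degree $1$) and $\omega$ (degree $2$), with $a(p)b(p)=\omega=-b(p)a(p)$ for all $p$ and with all other products of two basis elements of positive degree equal to $0$; and $H^*(\Sigma_g^{\times n})=H^*(\Sigma_g)^{\otimes n}$. For $1\le i\le n$ write $a_i(p),b_i(p),\omega_i\in H^*(\Sigma_g^{\times n})$ for the classes $a(p),b(p),\omega$ placed in the $i$-th tensor factor. Let $D_g$ be the ideal of $H^*(\Sigma_g^{\times n})$ generated by the elements $$\omega_i+\omega_j+\sum_{p=1}^g\bigl(b_i(p)a_j(p)-a_i(p)b_j(p)\bigr),\qquad 1\le i<j\le n,$$ and let $E(g)_\infty^{*,0}=H^*(\Sigma_g^{\times n})/D_g$. For an algebra $A$, an $s$-th zero-divisor of $A$ is an element of the kernel of the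 iterated multiplication $\mu_s\colon A^{\otimes s}\to A$, $a_1\otimes\cdots\otimes a_s\mapsto a_1\cdots a_s$. Put $x_1=a_1(1)$, $y_1=b_1(1)$, and $x_i=a_i(1)-a_1(1)$, $y_i=b_i(1)-b_1(1)$ for $2\le i\le n$. For $u\in H^*(\Sigma_g^{\times n})$ and $2\le\ell\le s$ let $$\delta_\ell(u)=u\otimes1\otimes\cdots\otimes1-1\otimes\cdots\otimes1\otimes u\otimes1\otimes\cdots\otimes1\in H^*(\Sigma_g^{\times n})^{\otimes s},$$ where the second $u$ stands in position $\ell$. Put $$\bar x_i=\prod_{\ell=2}^s\delta_\ell(x_i),\qquad \widetilde y_i=\delta_s(y_i)\quad(1\le i\le n),\qquad y_{1,i}=\delta_i(y_1)\quad(2\le i\le s-1),$$ and, if $g\ge2$, $c=\delta_2(a_1(2))$, $d=\delta_2(b_1(2))$ if $s=2$, and $d=\delta_3(b_1(2))$ if $s\ge3$. (Products are taken in increasing order of the index.) Theorem. (i) For $g=1$, the image of $$\Bigl(\prod_{i=2}^{s-1}y_{1,i}\Bigr)\cdot\Bigl(\prod_{i=1}^n\bar x_i\,\widetilde y_i\Bigr)$$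 in $(E(1)_\infty^{*,0})^{\otimes s}$ is a product of $s(n+1)-2$ $s$-th zero-divisors of $E(1)_\infty^{*,0}$, and it is non-zero. (ii) For every $g\ge2$, the image of $$c\cdot d\cdot\Bigl(\prod_{i=2}^{s-1}y_{1,i}\Bigr)\cdot\Bigl(\prod_{i=1}^n\bar x_i\,\widetilde y_i\Bigr)$$ in $(E(g)_\infty^{*,0})^{\otimes s}$ is a product of $s(n+1)$ $s$-th zero-divisors of $E(g)_\infty^{*,0}$, and it is non-zero. -/

import Mathlib

open scoped TensorProduct

noncomputable section

namespace SurfaceConf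

/-! ### Superalgebras and graded tensor powers -/

/-- A `ℤ/2`-grading on a rational algebra `A`, encoded by its parity automorphism
`a ↦ (-1)^{deg a} a`: even elements are fixed by it, odd elements change sign.  For a graded
algebra it holds exactly the information that enters the Koszul signs. -/
class SuperAlgebra (A : Type*) [Ring A] [Algebra ℚ A] where
  /-- The automorphism `a ↦ (-1)^{deg a} a`. -/
  parity : A →ₐ[ℚ] A
  parity_parity : ∀ a, parity (parity a) = a

open SuperAlgebra

section Parts

variable {A : Type*} [Ring A] [Algebra ℚ A] [SuperAlgebra A]

/-- `a` is homogeneous of degree `e` modulo `2`. -/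
def IsHomog (e : ℕ) (a : A) : Prop := parity a = (-1 : ℚ) ^ e • a

/-- The even (`e = 0`) and odd (`e = 1`) component of an element, `(a ± parity a) / 2`. -/
def part (e : Fin 2) : A →ₗ[ℚ] A :=
  (1 / 2 : ℚ) • (LinearMap.id + (-1 : ℚ) ^ (e : ℕ) • parity.toLinearMap)

lemma part_apply (e : Fin 2) (a : A) :
    part e a = (1 / 2 : ℚ) • (a + (-1 : ℚ) ^ (e : ℕ) • parity a) := rfl

lemma sum_part (a : A) : ∑ e : Fin 2, part e a = a := by
  simp only [Fin.sum_univ_two, part_apply]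
  simp only [Fin.val_zero, Fin.val_one, pow_zero, pow_one]
  module

lemma isHomog_part (e : Fin 2) (a : A) : IsHomog (e : ℕ) (part e a) := by
  unfold IsHomog
  fin_cases e <;> simp [part_apply, parity_parity, add_comm, ← sub_eq_add_neg, ← smul_neg]

lemma part_of_isHomog {e : Fin 2} {a : A} (h : IsHomog (e : ℕ) a) (e' : Fin 2) :
    part e' a = if e' = e then a else 0 := by
  unfold IsHomog at h
  rw [part_apply, h]
  fin_cases e <;> fin_cases e' <;> simp
  all_goals module

lemma isHomog_one : IsHomog 0 (1 : A) := by simp [IsHomog]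

lemma IsHomog.mul {e f : ℕ} {a b : A} (ha : IsHomog e a) (hb : IsHomog f b) :
    IsHomog (e + f) (a * b) := by
  unfold IsHomog at *
  rw [map_mul, ha, hb, smul_mul_smul_comm, pow_add]

lemma IsHomog.parity_pow {e : ℕ} {a : A} (ha : IsHomog e a) (k : ℕ) :
    (parity.toLinearMap ^ k : A →ₗ[ℚ] A) a = (-1 : ℚ) ^ (k * e) • a := by
  induction k with
  | zero => simp
  | succ k ih =>
    unfold IsHomog at ha
    rw [pow_succ', Module.End.mul_apply, ih, map_smul, AlgHom.toLinearMap_apply, ha, smul_smul]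
    congr 1
    ring

end Parts

/-- The `s`-fold tensor power `A ⊗ ⋯ ⊗ A` over `ℚ` of a superalgebra. As a vector space it is
Mathlib's tensor power; it carries the graded product
`(a₁ ⊗ ⋯ ⊗ aₛ) (b₁ ⊗ ⋯ ⊗ bₛ) = (-1)^{∑_{k > l} deg aₖ deg bₗ} a₁b₁ ⊗ ⋯ ⊗ aₛbₛ`
(see `GradedTensorPower.tprod_mul_tprod`). -/
def GradedTensorPower (s : ℕ) (A : Type*) [Ring A] [Algebra ℚ A] : Type _ :=
  ⨂[ℚ] _ : Fin s, A

namespace GradedTensorPower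

section Defs

variable {s : ℕ} {A : Type*} [Ring A] [Algebra ℚ A]

instance : AddCommGroup (GradedTensorPower s A) :=
  inferInstanceAs (AddCommGroup (⨂[ℚ] _ : Fin s, A))

instance : Module ℚ (GradedTensorPower s A) :=
  inferInstanceAs (Module ℚ (⨂[ℚ] _ : Fin s, A))

variable (s A) in
/-- The pure tensor `a₁ ⊗ ⋯ ⊗ aₛ`. -/
def tprod : MultilinearMap ℚ (fun _ : Fin s => A) (GradedTensorPower s A) :=
  PiTensorProduct.tprod ℚ

/-- The linear map `f₁ ⊗ ⋯ ⊗ fₛ` acting factorwise, without signs. -/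
def mapLin {B : Type*} [Ring B] [Algebra ℚ B] :
    MultilinearMap ℚ (fun _ : Fin s => A →ₗ[ℚ] B)
      (GradedTensorPower s A →ₗ[ℚ] GradedTensorPower s B) :=
  PiTensorProduct.mapMultilinear ℚ (fun _ : Fin s => A) (fun _ : Fin s => B)

/-- The linear map on the tensor power determined by a multilinear map. -/
def liftLin {M : Type*} [AddCommGroup M] [Module ℚ M]
    (f : MultilinearMap ℚ (fun _ : Fin s => A) M) : GradedTensorPower s A →ₗ[ℚ] M :=
  PiTensorProduct.lift f

@[simp] lemma liftLin_tprod {M : Type*} [AddCommGroup M] [Module ℚ M]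
    (f : MultilinearMap ℚ (fun _ : Fin s => A) M) (a : Fin s → A) :
    liftLin f (tprod s A a) = f a := PiTensorProduct.lift.tprod a

@[simp] lemma mapLin_tprod {B : Type*} [Ring B] [Algebra ℚ B] (f : Fin s → A →ₗ[ℚ] B)
    (a : Fin s → A) : mapLin f (tprod s A a) = tprod s B (fun l => f l (a l)) :=
  PiTensorProduct.map_tprod f a

lemma hom_ext {M : Type*} [AddCommGroup M] [Module ℚ M]
    {f g : GradedTensorPower s A →ₗ[ℚ] M}
    (h : ∀ a, f (tprod s A a) = g (tprod s A a)) : f = g :=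
  PiTensorProduct.ext (MultilinearMap.ext h)

variable [SuperAlgebra A]

lemma tprod_eq_sum (a : Fin s → A) :
    tprod s A a = ∑ e : Fin s → Fin 2, tprod s A (fun l => part (e l) (a l)) := by
  conv_lhs => rw [show a = fun l => ∑ e : Fin 2, part e (a l) from funext fun l => (sum_part _).symm]
  exact MultilinearMap.map_sum _ _

lemma hom_ext_homog {M : Type*} [AddCommGroup M] [Module ℚ M]
    {f g : GradedTensorPower s A →ₗ[ℚ] M}
    (h : ∀ (e : Fin s → Fin 2) (a : Fin s → A), (∀ l, IsHomog (e l : ℕ) (a l)) →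
      f (tprod s A a) = g (tprod s A a)) : f = g := by
  refine hom_ext fun a => ?_
  rw [tprod_eq_sum, map_sum, map_sum]
  exact Finset.sum_congr rfl fun e _ => h e _ fun l => isHomog_part _ _

/-- The total degree `∑_{k > l} eₖ` of the tensor factors to the right of position `l`. -/
def degAfter (e : Fin s → ℕ) (l : Fin s) : ℕ := ∑ k ∈ Finset.univ.filter (fun k => l < k), e k

/-- The linear map `a ↦ (b ↦ aᵉ · parityᵐ b)` where `aᵉ` is the component of `a` of parity `e`. -/
def mulFactor (e : Fin 2) (m : ℕ) : A →ₗ[ℚ] A →ₗ[ℚ] A :=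
  (LinearMap.lcomp ℚ A ((parity.toLinearMap : A →ₗ[ℚ] A) ^ m)) ∘ₗ (LinearMap.mul ℚ A) ∘ₗ part e

lemma mulFactor_apply (e : Fin 2) (m : ℕ) (a b : A) :
    mulFactor e m a b = part e a * ((parity.toLinearMap : A →ₗ[ℚ] A) ^ m) b := rfl

variable (s A) in
/-- The graded product as a bilinear map: for homogeneous `aₖ` the product
`(a₁ ⊗ ⋯ ⊗ aₛ) (b₁ ⊗ ⋯ ⊗ bₛ)` has the `l`-th factor `aₗ · parityᵐ bₗ`, with
`m = ∑_{k > l} deg aₖ`. -/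
def mulLin : GradedTensorPower s A →ₗ[ℚ] GradedTensorPower s A →ₗ[ℚ] GradedTensorPower s A :=
  liftLin (∑ e : Fin s → Fin 2,
    mapLin.compLinearMap (fun l => mulFactor (e l) (degAfter (fun k => (e k : ℕ)) l)))

lemma mulLin_tprod {e : Fin s → Fin 2} {a : Fin s → A} (ha : ∀ l, IsHomog (e l : ℕ) (a l))
    (b : Fin s → A) :
    mulLin s A (tprod s A a) (tprod s A b) = tprod s A (fun l => a l *
      ((parity.toLinearMap : A →ₗ[ℚ] A) ^ (degAfter (fun k => (e k : ℕ)) l)) (b l)) := by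
  rw [mulLin, liftLin_tprod, sum_apply, LinearMap.sum_apply,
    Finset.sum_eq_single e]
  · simp [mulFactor_apply, part_of_isHomog (ha _)]
  · intro e' _ hne
    obtain ⟨l, hl⟩ := Function.ne_iff.mp hne
    rw [MultilinearMap.compLinearMap_apply, mapLin_tprod]
    refine MultilinearMap.map_coord_zero _ l ?_
    rw [mulFactor_apply, part_of_isHomog (ha l), if_neg hl, zero_mul]
  · simp

lemma mulLin_tprod_homog {e f : Fin s → Fin 2} {a b : Fin s → A}
    (ha : ∀ l, IsHomog (e l : ℕ) (a l)) (hb : ∀ l, IsHomog (f l : ℕ) (b l)) :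
    mulLin s A (tprod s A a) (tprod s A b) =
      (-1 : ℚ) ^ (∑ l, degAfter (fun k => (e k : ℕ)) l * (f l : ℕ)) •
        tprod s A (fun l => a l * b l) := by
  rw [mulLin_tprod ha]
  simp_rw [(hb _).parity_pow, mul_smul_comm]
  rw [MultilinearMap.map_smul_univ, Finset.prod_pow_eq_pow_sum]

lemma IsHomog_mod {e : ℕ} {a : A} :
    IsHomog ((⟨e % 2, Nat.mod_lt _ two_pos⟩ : Fin 2) : ℕ) a ↔ IsHomog e a := by
  unfold IsHomog
  have : (-1 : ℚ) ^ (e % 2) = (-1 : ℚ) ^ e := by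
    rw [neg_one_pow_eq_pow_mod_two e]
  simp only [this]

lemma neg_one_pow_congr {a b : ℕ} (h : (a : ZMod 2) = b) : (-1 : ℚ) ^ a = (-1 : ℚ) ^ b := by
  rw [neg_one_pow_eq_pow_mod_two a, neg_one_pow_eq_pow_mod_two b,
    (ZMod.natCast_eq_natCast_iff' a b 2).mp h]

/-- The sign rule, for factors with arbitrary degrees. -/
lemma mulLin_tprod_nat {e f : Fin s → ℕ} {a b : Fin s → A}
    (ha : ∀ l, IsHomog (e l) (a l)) (hb : ∀ l, IsHomog (f l) (b l)) :
    mulLin s A (tprod s A a) (tprod s A b) =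
      (-1 : ℚ) ^ (∑ l, degAfter e l * f l) • tprod s A (fun l => a l * b l) := by
  rw [mulLin_tprod_homog (fun l => IsHomog_mod.mpr (ha l)) (fun l => IsHomog_mod.mpr (hb l))]
  congr 1
  apply neg_one_pow_congr
  simp [degAfter]

lemma mulLin_one_left (x : GradedTensorPower s A) :
    mulLin s A (tprod s A fun _ => 1) x = x := by
  suffices h : mulLin s A (tprod s A fun _ => 1) = LinearMap.id by rw [h]; rfl
  refine hom_ext_homog fun e a ha => ?_
  rw [mulLin_tprod_nat (e := fun _ => 0) (fun _ => isHomog_one) ha]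
  simp [degAfter]

lemma mulLin_one_right (x : GradedTensorPower s A) :
    mulLin s A x (tprod s A fun _ => 1) = x := by
  suffices h : (mulLin s A).flip (tprod s A fun _ => 1) = LinearMap.id from
    LinearMap.congr_fun h x
  refine hom_ext_homog fun e a ha => ?_
  rw [LinearMap.flip_apply, mulLin_tprod_nat (f := fun _ => 0) ha (fun _ => isHomog_one)]
  simp

lemma mulLin_assoc (x y z : GradedTensorPower s A) :
    mulLin s A (mulLin s A x y) z = mulLin s A x (mulLin s A y z) := by
  suffices h : (LinearMap.llcomp ℚ _ _ _ (mulLin s A)) ∘ₗ (mulLin s A) =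
      (LinearMap.lcomp ℚ _ (mulLin s A)) ∘ₗ (LinearMap.llcomp ℚ _ _ _) ∘ₗ (mulLin s A) from
    LinearMap.congr_fun (LinearMap.congr_fun (LinearMap.congr_fun h x) y) z
  refine hom_ext_homog fun e a ha => hom_ext_homog fun f b hb => hom_ext_homog fun g c hc => ?_
  change mulLin s A (mulLin s A (tprod s A a) (tprod s A b)) (tprod s A c) =
    mulLin s A (tprod s A a) (mulLin s A (tprod s A b) (tprod s A c))
  rw [mulLin_tprod_nat ha hb, mulLin_tprod_nat hb hc, map_smul, map_smul, LinearMap.smul_apply,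
    mulLin_tprod_nat (fun l => (ha l).mul (hb l)) hc,
    mulLin_tprod_nat ha (fun l => (hb l).mul (hc l)), smul_smul, smul_smul, ← pow_add, ← pow_add]
  simp only [mul_assoc]
  congr 2
  simp only [degAfter, Finset.sum_add_distrib, add_mul, mul_add]
  ring

instance : Ring (GradedTensorPower s A) where
  mul x y := mulLin s A x y
  one := tprod s A fun _ => 1
  mul_assoc := mulLin_assoc
  one_mul := mulLin_one_left
  mul_one := mulLin_one_right
  left_distrib x y z := map_add (mulLin s A x) y z
  right_distrib x y z := LinearMap.map_add₂ (mulLin s A) x y z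
  zero_mul x := LinearMap.map_zero₂ (mulLin s A) x
  mul_zero x := map_zero (mulLin s A x)
  zsmul := (· • ·)
  zsmul_zero' := SubNegMonoid.zsmul_zero'
  zsmul_succ' := SubNegMonoid.zsmul_succ'
  zsmul_neg' := SubNegMonoid.zsmul_neg'
  neg_add_cancel := neg_add_cancel

lemma mul_def (x y : GradedTensorPower s A) : x * y = mulLin s A x y := rfl

lemma one_def : (1 : GradedTensorPower s A) = tprod s A fun _ => 1 := rfl

instance : Algebra ℚ (GradedTensorPower s A) :=
  Algebra.ofModule (fun r x y => LinearMap.map_smul₂ (mulLin s A) r x y)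
    (fun r x y => map_smul (mulLin s A x) r y)

/-- The sign rule for the product in the tensor power. -/
lemma tprod_mul_tprod {e f : Fin s → ℕ} {a b : Fin s → A}
    (ha : ∀ l, IsHomog (e l) (a l)) (hb : ∀ l, IsHomog (f l) (b l)) :
    tprod s A a * tprod s A b =
      (-1 : ℚ) ^ (∑ l, (∑ k ∈ Finset.univ.filter (fun k => l < k), e k) * f l) •
        tprod s A (fun l => a l * b l) :=
  mulLin_tprod_nat ha hb

variable (s) in
/-- The algebra map `f ⊗ ⋯ ⊗ f` induced by a homomorphism `f` of superalgebras. -/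
def map {B : Type*} [Ring B] [Algebra ℚ B] [SuperAlgebra B] (f : A →ₐ[ℚ] B)
    (hf : ∀ a, f (parity a) = parity (f a)) :
    GradedTensorPower s A →ₐ[ℚ] GradedTensorPower s B :=
  AlgHom.ofLinearMap (mapLin fun _ => f.toLinearMap)
    (by rw [one_def, mapLin_tprod]; simp [one_def])
    (by
      have key : ∀ {e : ℕ} {a : A}, IsHomog e a → IsHomog e (f.toLinearMap a) := by
        intro e a h
        unfold IsHomog at *
        rw [AlgHom.toLinearMap_apply, ← hf, h, map_smul]
      intro x y
      suffices h : (LinearMap.llcomp ℚ _ _ _ (mapLin fun _ => f.toLinearMap)) ∘ₗ (mulLin s A) =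
          (LinearMap.lcomp ℚ _ (mapLin fun _ => f.toLinearMap)) ∘ₗ (mulLin s B) ∘ₗ
            (mapLin fun _ => f.toLinearMap) from LinearMap.congr_fun (LinearMap.congr_fun h x) y
      refine hom_ext_homog fun e a ha => hom_ext_homog fun e' b hb => ?_
      change mapLin (fun _ => f.toLinearMap) (mulLin s A (tprod s A a) (tprod s A b)) =
        mulLin s B (mapLin (fun _ => f.toLinearMap) (tprod s A a))
          (mapLin (fun _ => f.toLinearMap) (tprod s A b))
      rw [mulLin_tprod_nat ha hb, map_smul, mapLin_tprod, mapLin_tprod, mapLin_tprod,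
        mulLin_tprod_nat (fun l => key (ha l)) (fun l => key (hb l))]
      simp)

/-- The tensor power is again graded, by the total degree. -/
instance : SuperAlgebra (GradedTensorPower s A) where
  parity := map s parity fun _ => rfl
  parity_parity x := by
    suffices h : (map s parity fun _ => rfl).toLinearMap ∘ₗ
        (map s (parity : A →ₐ[ℚ] A) fun _ => rfl).toLinearMap = LinearMap.id from
      LinearMap.congr_fun h x
    refine hom_ext fun a => ?_
    change mapLin _ (mapLin _ (tprod s A a)) = tprod s A a
    rw [mapLin_tprod, mapLin_tprod]
    simp [parity_parity]

/-- The element `1 ⊗ ⋯ ⊗ 1 ⊗ a ⊗ 1 ⊗ ⋯ ⊗ 1` with `a` in position `k`. -/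
def single (k : Fin s) (a : A) : GradedTensorPower s A :=
  tprod s A (Function.update (fun _ => 1) k a)

variable (s A) in
/-- The iterated multiplication `μₛ : A ⊗ ⋯ ⊗ A → A`, `a₁ ⊗ ⋯ ⊗ aₛ ↦ a₁ ⋯ aₛ`. -/
def iteratedMul : GradedTensorPower s A →ₗ[ℚ] A :=
  liftLin (MultilinearMap.mkPiAlgebraFin ℚ s A)

/-- An `s`-th zero-divisor of `A` is an element of the kernel of `μₛ`. -/
def IsZeroDivisor (z : GradedTensorPower s A) : Prop := iteratedMul s A z = 0

/-- The element `u ⊗ 1 ⊗ ⋯ ⊗ 1 - 1 ⊗ ⋯ ⊗ 1 ⊗ u ⊗ 1 ⊗ ⋯ ⊗ 1`, with the second `u` in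
position `l` and positions numbered from `0`. -/
def diff (u : A) (l : Fin s) : GradedTensorPower s A :=
  single ⟨0, l.pos⟩ u - single l u

end Defs

end GradedTensorPower

/-! ### The cohomology algebra of an orientable surface and of its cartesian powers -/

/-- The rational cohomology algebra `H^*(Σ_g) = H⁰ ⊕ H¹ ⊕ H²` of the closed orientable surface
of genus `g`. An element `⟨r, α, β, w⟩` stands for `r + ∑ₚ αₚ a(p) + ∑ₚ βₚ b(p) + w ω`. -/
@[ext]
structure HSurface (g : ℕ) where
  /-- The coefficient of the unit. -/
  deg0 : ℚ
  /-- The coefficients of the classes `a(p)`. -/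
  coeffA : Fin g → ℚ
  /-- The coefficients of the classes `b(p)`. -/
  coeffB : Fin g → ℚ
  /-- The coefficient of `ω`. -/
  deg2 : ℚ

namespace HSurface

variable {g : ℕ}

instance : Zero (HSurface g) := ⟨⟨0, 0, 0, 0⟩⟩
instance : One (HSurface g) := ⟨⟨1, 0, 0, 0⟩⟩
instance : Add (HSurface g) := ⟨fun x y =>
  ⟨x.deg0 + y.deg0, x.coeffA + y.coeffA, x.coeffB + y.coeffB, x.deg2 + y.deg2⟩⟩
instance : Neg (HSurface g) := ⟨fun x => ⟨-x.deg0, -x.coeffA, -x.coeffB, -x.deg2⟩⟩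
instance : SMul ℚ (HSurface g) := ⟨fun r x =>
  ⟨r * x.deg0, r • x.coeffA, r • x.coeffB, r * x.deg2⟩⟩

/-- The cup product, which is determined by `a(p) b(p) = ω = - b(p) a(p)` and the vanishing of
all other products of two basis elements of positive degree. -/
instance : Mul (HSurface g) := ⟨fun x y =>
  ⟨x.deg0 * y.deg0, x.deg0 • y.coeffA + y.deg0 • x.coeffA, x.deg0 • y.coeffB + y.deg0 • x.coeffB,
    x.deg0 * y.deg2 + x.deg2 * y.deg0 + ∑ p, (x.coeffA p * y.coeffB p - x.coeffB p * y.coeffA p)⟩⟩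

@[simp] lemma zero_deg0 : (0 : HSurface g).deg0 = 0 := rfl
@[simp] lemma zero_coeffA : (0 : HSurface g).coeffA = 0 := rfl
@[simp] lemma zero_coeffB : (0 : HSurface g).coeffB = 0 := rfl
@[simp] lemma zero_deg2 : (0 : HSurface g).deg2 = 0 := rfl
@[simp] lemma one_deg0 : (1 : HSurface g).deg0 = 1 := rfl
@[simp] lemma one_coeffA : (1 : HSurface g).coeffA = 0 := rfl
@[simp] lemma one_coeffB : (1 : HSurface g).coeffB = 0 := rfl
@[simp] lemma one_deg2 : (1 : HSurface g).deg2 = 0 := rfl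
@[simp] lemma add_deg0 (x y : HSurface g) : (x + y).deg0 = x.deg0 + y.deg0 := rfl
@[simp] lemma add_coeffA (x y : HSurface g) : (x + y).coeffA = x.coeffA + y.coeffA := rfl
@[simp] lemma add_coeffB (x y : HSurface g) : (x + y).coeffB = x.coeffB + y.coeffB := rfl
@[simp] lemma add_deg2 (x y : HSurface g) : (x + y).deg2 = x.deg2 + y.deg2 := rfl
@[simp] lemma neg_deg0 (x : HSurface g) : (-x).deg0 = -x.deg0 := rfl
@[simp] lemma neg_coeffA (x : HSurface g) : (-x).coeffA = -x.coeffA := rfl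
@[simp] lemma neg_coeffB (x : HSurface g) : (-x).coeffB = -x.coeffB := rfl
@[simp] lemma neg_deg2 (x : HSurface g) : (-x).deg2 = -x.deg2 := rfl
@[simp] lemma smul_deg0 (r : ℚ) (x : HSurface g) : (r • x).deg0 = r * x.deg0 := rfl
@[simp] lemma smul_coeffA (r : ℚ) (x : HSurface g) : (r • x).coeffA = r • x.coeffA := rfl
@[simp] lemma smul_coeffB (r : ℚ) (x : HSurface g) : (r • x).coeffB = r • x.coeffB := rfl
@[simp] lemma smul_deg2 (r : ℚ) (x : HSurface g) : (r • x).deg2 = r * x.deg2 := rfl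
@[simp] lemma mul_deg0 (x y : HSurface g) : (x * y).deg0 = x.deg0 * y.deg0 := rfl
@[simp] lemma mul_coeffA (x y : HSurface g) :
    (x * y).coeffA = x.deg0 • y.coeffA + y.deg0 • x.coeffA := rfl
@[simp] lemma mul_coeffB (x y : HSurface g) :
    (x * y).coeffB = x.deg0 • y.coeffB + y.deg0 • x.coeffB := rfl
@[simp] lemma mul_deg2 (x y : HSurface g) : (x * y).deg2 = x.deg0 * y.deg2 + x.deg2 * y.deg0 +
    ∑ p, (x.coeffA p * y.coeffB p - x.coeffB p * y.coeffA p) := rfl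

instance : AddCommGroup (HSurface g) where
  add_assoc x y z := by ext <;> simp [add_assoc]
  zero_add x := by ext <;> simp
  add_zero x := by ext <;> simp
  add_comm x y := by ext <;> simp [add_comm]
  neg_add_cancel x := by ext <;> simp
  nsmul := nsmulRec
  zsmul := zsmulRec

instance : Ring (HSurface g) where
  mul_assoc x y z := by
    ext p
    · simp [mul_assoc]
    · simp; ring
    · simp; ring
    · have key : (∑ p, (x.coeffA p * y.coeffB p - x.coeffB p * y.coeffA p)) * z.deg0 +
          ∑ p, ((x * y).coeffA p * z.coeffB p - (x * y).coeffB p * z.coeffA p) =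
          x.deg0 * (∑ p, (y.coeffA p * z.coeffB p - y.coeffB p * z.coeffA p)) +
          ∑ p, (x.coeffA p * (y * z).coeffB p - x.coeffB p * (y * z).coeffA p) := by
        rw [Finset.sum_mul, Finset.mul_sum, ← Finset.sum_add_distrib, ← Finset.sum_add_distrib]
        refine Finset.sum_congr rfl fun p _ => ?_
        simp only [mul_coeffA, mul_coeffB, Pi.add_apply, Pi.smul_apply, smul_eq_mul]
        ring
      simp only [mul_deg2 (x * y) z, mul_deg2 x (y * z), mul_deg0, mul_deg2 x y, mul_deg2 y z]
      linear_combination key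
  one_mul x := by ext <;> simp
  mul_one x := by ext <;> simp
  left_distrib x y z := by
    ext p
    · simp [mul_add]
    · simp; ring
    · simp; ring
    · simp [Finset.sum_sub_distrib, Finset.sum_add_distrib, mul_add]
      ring
  right_distrib x y z := by
    ext p
    · simp [add_mul]
    · simp; ring
    · simp; ring
    · simp [Finset.sum_sub_distrib, Finset.sum_add_distrib, add_mul]
      ring
  zero_mul x := by ext <;> simp
  mul_zero x := by ext <;> simp
  zsmul := zsmulRec
  neg_add_cancel := neg_add_cancel

instance : Module ℚ (HSurface g) where
  one_smul x := by ext <;> simp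
  mul_smul r t x := by ext <;> simp [mul_assoc]
  smul_zero r := by ext <;> simp
  smul_add r x y := by ext <;> simp [mul_add]
  add_smul r t x := by ext <;> simp [add_mul]
  zero_smul x := by ext <;> simp

instance : Algebra ℚ (HSurface g) := Algebra.ofModule
  (fun r x y => by
    ext p
    · simp [mul_assoc]
    · simp; ring
    · simp; ring
    · simp [Finset.sum_sub_distrib, mul_add, mul_sub, Finset.mul_sum, mul_assoc])
  (fun r x y => by
    ext p
    · simp [mul_left_comm]
    · simp; ring
    · simp; ring
    · simp [Finset.sum_sub_distrib, mul_add, mul_sub, Finset.mul_sum, mul_left_comm])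

/-- `H⁰` and `H²` are even, `H¹` is odd. -/
instance : SuperAlgebra (HSurface g) where
  parity := AlgHom.ofLinearMap
    { toFun := fun x => ⟨x.deg0, -x.coeffA, -x.coeffB, x.deg2⟩
      map_add' := fun x y => by ext <;> simp [add_comm]
      map_smul' := fun r x => by ext <;> simp }
    (by ext <;> simp)
    (fun x y => by ext <;> simp [add_comm])
  parity_parity x := by
    change (⟨x.deg0, - -x.coeffA, - -x.coeffB, x.deg2⟩ : HSurface g) = x
    simp

/-- The class `a(p)`, with `p` numbered from `0`. -/
def a (p : Fin g) : HSurface g := ⟨0, Pi.single p 1, 0, 0⟩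

/-- The class `b(p)`, with `p` numbered from `0`. -/
def b (p : Fin g) : HSurface g := ⟨0, 0, Pi.single p 1, 0⟩

/-- The class `ω`. -/
def omega : HSurface g := ⟨0, 0, 0, 1⟩

end HSurface

/-- `H^*(Σ_g^{×n}) = H^*(Σ_g) ⊗ ⋯ ⊗ H^*(Σ_g)`, with `n` factors. -/
abbrev HPower (g n : ℕ) : Type := GradedTensorPower n (HSurface g)

section Elements

variable {g n : ℕ}

/-- The class `a_i(p)`, with `i` and `p` numbered from `0`. -/
def a (i : Fin n) (p : Fin g) : HPower g n := GradedTensorPower.single i (HSurface.a p)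

/-- The class `b_i(p)`, with `i` and `p` numbered from `0`. -/
def b (i : Fin n) (p : Fin g) : HPower g n := GradedTensorPower.single i (HSurface.b p)

/-- The class `ω_i`, with `i` numbered from `0`. -/
def omega (i : Fin n) : HPower g n := GradedTensorPower.single i HSurface.omega

/-- The class `x_i(p)`; it is `a_i(p)`, except that `x_i(1) = a_i(1) - a_1(1)` for `i ≥ 2`
(in the numbering from `1`). -/
def x (i : Fin n) (p : Fin g) : HPower g n :=
  if (p : ℕ) = 0 ∧ (i : ℕ) ≠ 0 then a i p - a ⟨0, i.pos⟩ p else a i p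

/-- The class `y_i(p)`; it is `b_i(p)`, except that `y_i(1) = b_i(1) - b_1(1)` for `i ≥ 2`
(in the numbering from `1`). -/
def y (i : Fin n) (p : Fin g) : HPower g n :=
  if (p : ℕ) = 0 ∧ (i : ℕ) ≠ 0 then b i p - b ⟨0, i.pos⟩ p else b i p

end Elements

/-! ### The quotient algebra -/

/-- The element `ω_i + ω_j + ∑ₚ (b_i(p) a_j(p) - a_i(p) b_j(p))`. -/
def diagonalClass (g : ℕ) {n : ℕ} (i j : Fin n) : HPower g n :=
  omega i + omega j + ∑ p : Fin g, (b i p * a j p - a i p * b j p)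

/-- The (two-sided) ideal `D_g` generated by the diagonal classes for `i < j`. -/
def idealD (g n : ℕ) : Ideal (HPower g n) :=
  (TwoSidedIdeal.span {d | ∃ i j : Fin n, i < j ∧ d = diagonalClass g i j}).asIdeal

instance (g n : ℕ) : (idealD g n).IsTwoSided :=
  inferInstanceAs (TwoSidedIdeal.asIdeal _).IsTwoSided

/-- The algebra `E(g)_∞^{*,0} = H^*(Σ_g^{×n}) / D_g`. -/
abbrev EInfty (g n : ℕ) : Type := HPower g n ⧸ idealD g n

/-- The projection `H^*(Σ_g^{×n}) → E(g)_∞^{*,0}`. -/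
def toEInfty (g n : ℕ) : HPower g n →ₐ[ℚ] EInfty g n := Ideal.Quotient.mkₐ ℚ (idealD g n)

lemma parity_single_tensor {g n : ℕ} (i : Fin n) (u : HSurface g) :
    parity (GradedTensorPower.single i u) = GradedTensorPower.single i (parity u) := by
  change GradedTensorPower.mapLin _ (GradedTensorPower.tprod _ _ _) = _
  rw [GradedTensorPower.mapLin_tprod, GradedTensorPower.single]
  congr 1
  ext1 l
  by_cases h : l = i
  · subst h; simp
  · simp [h]

lemma single_neg {g n : ℕ} (i : Fin n) (u : HSurface g) :
    GradedTensorPower.single i (-u) = -GradedTensorPower.single i u := by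
  have := (GradedTensorPower.tprod n (HSurface g)).map_update_smul (fun _ => 1) i (-1 : ℚ) u
  rwa [neg_one_smul, neg_one_smul] at this

lemma parity_diagonalClass {g n : ℕ} (i j : Fin n) :
    parity (diagonalClass g i j) = diagonalClass g i j := by
  have ha : ∀ p : Fin g, parity (HSurface.a p) = -HSurface.a p := fun p => by
    change (⟨_, _, _, _⟩ : HSurface g) = _
    ext <;> simp [HSurface.a]
  have hb : ∀ p : Fin g, parity (HSurface.b p) = -HSurface.b p := fun p => by
    change (⟨_, _, _, _⟩ : HSurface g) = _
    ext <;> simp [HSurface.b]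
  have hw : parity (HSurface.omega : HSurface g) = HSurface.omega := by
    change (⟨_, _, _, _⟩ : HSurface g) = _
    ext <;> simp [HSurface.omega]
  simp only [diagonalClass, a, b, omega, map_add, map_sum, map_sub, map_mul, parity_single_tensor,
    ha, hb, hw, single_neg, neg_mul_neg]

lemma idealD_le_comap_parity (g n : ℕ) :
    ∀ z ∈ idealD g n, (parity z : HPower g n) ∈ idealD g n := by
  have h : TwoSidedIdeal.span {d | ∃ i j : Fin n, i < j ∧ d = diagonalClass g i j} ≤
      (TwoSidedIdeal.span {d | ∃ i j : Fin n, i < j ∧ d = diagonalClass g i j}).comap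
        (parity : HPower g n →ₐ[ℚ] HPower g n) := by
    rw [TwoSidedIdeal.span_le]
    rintro _ ⟨i, j, hij, rfl⟩
    rw [SetLike.mem_coe, TwoSidedIdeal.mem_comap, parity_diagonalClass]
    exact TwoSidedIdeal.subset_span ⟨i, j, hij, rfl⟩
  intro z hz
  exact (TwoSidedIdeal.mem_comap (parity : HPower g n →ₐ[ℚ] HPower g n)).mp (h hz)

/-- The grading of the quotient induced from that of `H^*(Σ_g^{×n})`. -/
instance (g n : ℕ) : SuperAlgebra (EInfty g n) where
  parity := Ideal.Quotient.liftₐ (idealD g n) ((toEInfty g n).comp parity) fun z hz =>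
    Ideal.Quotient.eq_zero_iff_mem.mpr (idealD_le_comap_parity g n z hz)
  parity_parity z := by
    obtain ⟨z, rfl⟩ := Ideal.Quotient.mk_surjective z
    change Ideal.Quotient.mk (idealD g n) (parity (parity z)) = _
    rw [parity_parity]

/-- The map `H^*(Σ_g^{×n})^{⊗s} → (E(g)_∞^{*,0})^{⊗s}` induced by the projection. -/
def imageInE (g n s : ℕ) :
    GradedTensorPower s (HPower g n) →ₐ[ℚ] GradedTensorPower s (EInfty g n) :=
  GradedTensorPower.map s (toEInfty g n) fun _ => rfl

/-! ### The zero-divisors -/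

section ZeroDivisors

open GradedTensorPower

variable {g n : ℕ}

/-- `ū = ∏_{ℓ=2}^{s} (u ⊗ 1 ⊗ ⋯ ⊗ 1 - 1 ⊗ ⋯ ⊗ u ⊗ ⋯ ⊗ 1)`, with the second `u` in
position `ℓ`; in the numbering from `0` the positions are `1, …, s - 1`. -/
def bar (s : ℕ) (u : HPower g n) : GradedTensorPower s (HPower g n) :=
  ((List.finRange s).tail.map (diff u)).prod

/-- `ũ = u ⊗ 1 ⊗ ⋯ ⊗ 1 - 1 ⊗ ⋯ ⊗ 1 ⊗ u`. -/
def tilde {s : ℕ} (hs : 2 ≤ s) (u : HPower g n) : GradedTensorPower s (HPower g n) :=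
  diff u ⟨s - 1, by omega⟩

/-- `∏_{i=2}^{s-1} y_{1,i}`, where `y_{1,i}` is `y_1 ⊗ 1 ⊗ ⋯ ⊗ 1 - 1 ⊗ ⋯ ⊗ y_1 ⊗ ⋯ ⊗ 1` with the
second `y_1` in position `i`; in the numbering from `0` the positions are `1, …, s - 2`. -/
def prodY1 (s : ℕ) (hg : 1 ≤ g) (hn : 1 ≤ n) : GradedTensorPower s (HPower g n) :=
  ((List.finRange s).tail.dropLast.map
    (diff (y (⟨0, hn⟩ : Fin n) (⟨0, hg⟩ : Fin g)))).prod

/-- `∏_{i=1}^{n} x̄_i ỹ_i`, where `x_i = x_i(1)` and `y_i = y_i(1)`. -/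
def prodXY {s : ℕ} (hs : 2 ≤ s) (n : ℕ) (hg : 1 ≤ g) : GradedTensorPower s (HPower g n) :=
  ((List.finRange n).map fun i =>
    bar s (x i (⟨0, hg⟩ : Fin g)) * tilde hs (y i (⟨0, hg⟩ : Fin g))).prod

/-- `c = a_1(2) ⊗ 1 ⊗ ⋯ ⊗ 1 - 1 ⊗ a_1(2) ⊗ 1 ⊗ ⋯ ⊗ 1`. -/
def c {s : ℕ} (hs : 2 ≤ s) (hg : 2 ≤ g) (hn : 1 ≤ n) : GradedTensorPower s (HPower g n) :=
  diff (a (⟨0, hn⟩ : Fin n) (⟨1, hg⟩ : Fin g)) ⟨1, hs⟩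

/-- `d = b_1(2) ⊗ 1 - 1 ⊗ b_1(2)` if `s = 2`, and
`d = b_1(2) ⊗ 1 ⊗ ⋯ ⊗ 1 - 1 ⊗ 1 ⊗ b_1(2) ⊗ 1 ⊗ ⋯ ⊗ 1` if `s ≥ 3`. -/
def d {s : ℕ} (hs : 2 ≤ s) (hg : 2 ≤ g) (hn : 1 ≤ n) : GradedTensorPower s (HPower g n) :=
  if h : 3 ≤ s then diff (b (⟨0, hn⟩ : Fin n) (⟨1, hg⟩ : Fin g)) ⟨2, h⟩
  else diff (b (⟨0, hn⟩ : Fin n) (⟨1, hg⟩ : Fin g)) ⟨1, hs⟩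

/-- `z` is the product of a list of `m` many `s`-th zero-divisors of `A`. -/
def IsProdOfZeroDivisors {s : ℕ} {A : Type*} [Ring A] [Algebra ℚ A] [SuperAlgebra A] (m : ℕ)
    (z : GradedTensorPower s A) : Prop :=
  ∃ L : List (GradedTensorPower s A), L.length = m ∧ (∀ u ∈ L, IsZeroDivisor u) ∧ L.prod = z

end ZeroDivisors

end SurfaceConf

end

/-!
Write `A = H^*(Σ_g^{×n})` and `E = A / D_g`. Both tensor powers in sight are graded commutative, so
the argument runs with products of odd elements, which behave like exterior products.

*Passing from `E` to `A`.* For a family of odd classes `u_i` pulled back from one factor `Σ_g`, the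
class `η = ∏_{i ≥ 2} (u_i - u_1)` is annihilated by every diagonal class `d_{ij}`: the product `η`
contains `u_i - u_j` as a factor up to sign, and `d_{ij} (u_i - u_j) = 0`
(`diagonalClass_mul_prod_differences`). Hence `η` annihilates `D_g`, and if `η_1, …, η_s` are such
classes, then multiplication by `η_1 ⊗ ⋯ ⊗ η_s` on `A^{⊗s}` factors over `E^{⊗s}`
(`annihilator_mul_eq_zero`). So it suffices that the product of zero-divisors, multiplied by
`η_1 ⊗ ⋯ ⊗ η_s`, is non-zero in `A^{⊗s}`. The choice that works is `u_i = b_i(1)` in the first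
`s - 1` positions and `u_i = a_i(1)` in the last one.

*The genus one part.* Let `Q` be the product of `η_1 ⊗ ⋯ ⊗ η_s` with
`(∏ y_{1,i}) (∏ x̄_i ỹ_i)`. It is a product of `2sn - 2` linear forms in the `2sn` classes `a_i(1)`,
`b_i(1)` in the `s` positions. Together with `a_1(1)` and `b_1(1)` in the first position these forms
span all the `2sn` classes (`single_mem_of_factors_subset`), and the product of the latter is the
fundamental class. By the uniqueness of alternating forms in top degree
(`SuperCommutative.prod_ne_zero_of_mem_span`), the product `ω_1 Q`, with `ω_1` in the first position,
is non-zero (`single_mul_factors_prod_ne_zero`); in particular `Q ≠ 0`.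

*The factors `c` and `d`.* The class `a_1(2)` in position `k` times `b_1(2)` in position `l` kills
`a_1(1)` in both positions. If `k ≠ l`, then `Q` has the difference of `a_1(1)` in these positions as
a factor, and the product with `Q` vanishes; if `k = l`, it is `ω_1` in position `k` times `Q`, which
does not depend on `k`. So `c d Q` is `ω_1 Q`, or `2 ω_1 Q` if `s = 2`
(`c_mul_d_mul_factors_prod`).
-/

noncomputable section

namespace SurfaceConf

open SuperAlgebra GradedTensorPower

/-! ### Products of lists of odd elements -/

section OddLists

variable {A : Type*} [Ring A] [Algebra ℚ A]

/-- Graded commutativity: homogeneous elements satisfy `a b = (-1)^{deg a deg b} b a`. -/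
def SuperCommutative (A : Type*) [Ring A] [Algebra ℚ A] [SuperAlgebra A] : Prop :=
  ∀ ⦃e f : ℕ⦄ ⦃a b : A⦄, IsHomog e a → IsHomog f b → a * b = (-1 : ℚ) ^ (e * f) • (b * a)

variable [SuperAlgebra A]

lemma IsHomog.add {e : ℕ} {a b : A} (ha : IsHomog e a) (hb : IsHomog e b) :
    IsHomog e (a + b) := by
  unfold IsHomog at *
  rw [map_add, ha, hb, smul_add]

lemma IsHomog.smul {e : ℕ} {a : A} (r : ℚ) (ha : IsHomog e a) : IsHomog e (r • a) := by
  unfold IsHomog at *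
  rw [map_smul, ha, smul_comm]

lemma IsHomog.sub {e : ℕ} {a b : A} (ha : IsHomog e a) (hb : IsHomog e b) :
    IsHomog e (a - b) := by
  unfold IsHomog at *
  rw [map_sub, ha, hb, smul_sub]

lemma isHomog_zero (e : ℕ) : IsHomog e (0 : A) := by simp [IsHomog]

/-- The odd part of a superalgebra. -/
def oddPart (A : Type*) [Ring A] [Algebra ℚ A] [SuperAlgebra A] : Submodule ℚ A where
  carrier := {a | IsHomog 1 a}
  add_mem' := IsHomog.add
  zero_mem' := isHomog_zero 1
  smul_mem' := fun r _ h => h.smul r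

lemma isHomog_list_prod {L : List A} (hL : ∀ u ∈ L, IsHomog 1 u) :
    IsHomog L.length L.prod := by
  induction L with
  | nil => simpa using isHomog_one
  | cons u L ih =>
    rw [List.prod_cons, List.length_cons, add_comm]
    exact (hL u (by simp)).mul (ih fun v hv => hL v (by simp [hv]))

namespace SuperCommutative

variable (hA : SuperCommutative A)
include hA

lemma odd_mul_odd {a b : A} (ha : IsHomog 1 a) (hb : IsHomog 1 b) : a * b = -(b * a) := by
  simpa using hA ha hb

lemma odd_mul_self {a : A} (ha : IsHomog 1 a) : a * a = 0 := by
  have h := hA.odd_mul_odd ha ha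
  have h2 : (2 : ℚ) • (a * a) = 0 := by rw [two_smul]; nth_rw 1 [h]; exact neg_add_cancel _
  exact (smul_eq_zero.mp h2).resolve_left two_ne_zero

lemma even_mul {e : ℕ} {a b : A} (ha : IsHomog 2 a) (hb : IsHomog e b) : a * b = b * a := by
  rw [hA ha hb, pow_mul, neg_one_sq, one_pow, one_smul]

/-- Permuting odd factors changes a product at most by its sign. -/
lemma prod_perm {L L' : List A} (h : L.Perm L') (hL : ∀ u ∈ L, IsHomog 1 u) :
    L.prod = L'.prod ∨ L.prod = -L'.prod := by
  induction h with
  | nil => simp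
  | cons u _ ih =>
    rcases ih fun v hv => hL v (by simp [hv]) with h | h <;> simp [h]
  | swap u v L =>
    right
    rw [List.prod_cons, List.prod_cons, List.prod_cons, List.prod_cons, ← mul_assoc, ← mul_assoc,
      hA.odd_mul_odd (hL v (by simp)) (hL u (by simp)), neg_mul]
  | trans h₁ _ ih₁ ih₂ =>
    rcases ih₁ hL with h | h <;> rcases ih₂ fun v hv => hL v (h₁.mem_iff.mpr hv) with h' | h' <;>
      simp [h, h']

lemma mul_prod_of_mem_span {L : List A} (hL : ∀ u ∈ L, IsHomog 1 u) {z : A}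
    (hz : z ∈ Submodule.span ℚ {u | u ∈ L}) : z * L.prod = 0 := by
  induction hz using Submodule.span_induction with
  | mem u hu =>
    obtain ⟨L₁, L₂, rfl⟩ := List.append_of_mem hu
    have h0 : u * (u :: (L₁ ++ L₂)).prod = 0 := by
      rw [List.prod_cons, ← mul_assoc, hA.odd_mul_self (hL u hu), zero_mul]
    rcases hA.prod_perm List.perm_middle hL with h | h <;> rw [h]
    · exact h0
    · rw [mul_neg, h0, neg_zero]
  | zero => exact zero_mul _
  | add u v _ _ hu hv => rw [add_mul, hu, hv, add_zero]
  | smul r u _ hu => rw [smul_mul_assoc, hu, smul_zero]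

/-- One factor `u` of a product of odd elements may be replaced by any `z` that is congruent to it
modulo the span of the other factors; hence the product is killed by whatever kills `z`. -/
lemma mul_prod_eq_zero {L L' : List A} {u z w : A} (hL : ∀ v ∈ L, IsHomog 1 v)
    (hp : L.Perm (u :: L')) (hz : u - z ∈ Submodule.span ℚ {v | v ∈ L'}) (hw : w * z = 0) :
    w * L.prod = 0 := by
  have h0 : w * (u :: L').prod = 0 := by
    have := hA.mul_prod_of_mem_span
      (fun v hv => hL v (hp.mem_iff.mpr (List.mem_cons_of_mem _ hv))) hz
    rw [List.prod_cons, ← sub_add_cancel u z, add_mul, this, zero_add, ← mul_assoc, hw, zero_mul]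
  rcases hA.prod_perm hp hL with h | h <;> rw [h]
  · exact h0
  · rw [mul_neg, h0, neg_zero]

/-- The product of `N` odd elements as an alternating map. -/
def prodAlternating (N : ℕ) (V : Submodule ℚ A) (hV : V ≤ oddPart A) : V [⋀^Fin N]→ₗ[ℚ] A :=
  (ExteriorAlgebra.lift ℚ
    ⟨V.subtype, fun v => hA.odd_mul_self (hV v.2)⟩).toLinearMap.compAlternatingMap
      (ExteriorAlgebra.ιMulti ℚ N)

lemma prodAlternating_apply (N : ℕ) (V : Submodule ℚ A) (hV : V ≤ oddPart A) (v : Fin N → V) :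
    hA.prodAlternating N V hV v = (List.ofFn fun i => (v i : A)).prod := by
  simp [prodAlternating, ExteriorAlgebra.ιMulti_apply, map_list_prod, List.map_ofFn,
    Function.comp_def]

/-- A non-vanishing product of `N` odd elements forces any `N` odd elements whose span contains
them to have a non-vanishing product: the latter are a basis of their span, and an alternating map
in top degree which vanishes on a basis is zero. -/
lemma prod_ne_zero_of_mem_span {L₁ L₂ : List A} (h₂ : ∀ u ∈ L₂, IsHomog 1 u)
    (hlen : L₁.length = L₂.length) (hspan : ∀ u ∈ L₁, u ∈ Submodule.span ℚ {v | v ∈ L₂})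
    (hne : L₁.prod ≠ 0) : L₂.prod ≠ 0 := by
  set V := Submodule.span ℚ {v | v ∈ L₂} with hVdef
  have hV : V ≤ oddPart A := Submodule.span_le.mpr h₂
  set N := L₂.length with hN
  let v₂ : Fin N → V := fun i => ⟨L₂.get i, Submodule.subset_span (L₂.get_mem i)⟩
  let v₁ : Fin N → V := fun i =>
    ⟨L₁.get (i.cast hlen.symm), hspan _ (L₁.get_mem (i.cast hlen.symm))⟩
  have hF₂ : hA.prodAlternating N V hV v₂ = L₂.prod := by
    rw [prodAlternating_apply]
    congr 1
    exact List.ofFn_get L₂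
  have hF₁ : hA.prodAlternating N V hV v₁ = L₁.prod := by
    rw [prodAlternating_apply]
    congr 1
    conv_rhs => rw [← List.ofFn_get L₁]
    exact (List.ofFn_congr hlen _).symm
  have htop : ⊤ ≤ Submodule.span ℚ (Set.range v₂) := by
    rintro ⟨z, hz⟩ -
    have hr : V.subtype '' Set.range v₂ = {v | v ∈ L₂} := by
      ext z
      simp only [Set.mem_image, Set.mem_range, exists_exists_eq_and, Set.mem_ofPred_eq]
      exact List.mem_iff_get.symm
    have h : z ∈ (Submodule.span ℚ (Set.range v₂)).map V.subtype := by
      rw [Submodule.map_span, hr]; exact hz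
    obtain ⟨y, hy, rfl⟩ := h
    exact hy
  have : Module.Finite ℚ V := ⟨⟨(Set.finite_range v₂).toFinset, by
    rw [Set.Finite.coe_toFinset]; exact top_le_iff.mp htop⟩⟩
  have hLI : LinearIndependent ℚ v₁ := by
    by_contra h
    exact hne (hF₁ ▸ AlternatingMap.map_linearDependent _ _ h)
  have hcard : Fintype.card (Fin N) = Module.finrank ℚ V := by
    refine le_antisymm hLI.fintype_card_le_finrank ?_
    have := finrank_range_le_card (R := ℚ) v₂
    rwa [Set.finrank, top_le_iff.mp htop, finrank_top] at this
  let e := basisOfTopLeSpanOfCardEqFinrank v₂ htop hcard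
  intro h0
  have hzero : hA.prodAlternating N V hV = 0 := by
    refine e.ext_alternating fun σ hσ => ?_
    have he : (e : Fin N → V) = v₂ := coe_basisOfTopLeSpanOfCardEqFinrank v₂ htop hcard
    let τ : Equiv.Perm (Fin N) := Equiv.ofBijective σ (Finite.injective_iff_bijective.mp hσ)
    have := (hA.prodAlternating N V hV).map_perm v₂ τ
    rw [hF₂, h0, smul_zero] at this
    rw [he]
    exact this
  exact hne (by rw [← hF₁, hzero]; rfl)

end SuperCommutative

end OddLists

/-! ### Tensor powers of superalgebras -/

namespace GradedTensorPower

variable {s : ℕ} {A : Type*} [Ring A] [Algebra ℚ A] [SuperAlgebra A]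

lemma isHomog_tprod {e : Fin s → ℕ} {a : Fin s → A} (ha : ∀ l, IsHomog (e l) (a l)) :
    IsHomog (∑ l, e l) (tprod s A a) := by
  change mapLin _ (tprod s A a) = _
  rw [mapLin_tprod]
  have : (fun l => (parity : A →ₐ[ℚ] A).toLinearMap (a l)) =
      fun l => (-1 : ℚ) ^ e l • a l := funext fun l => ha l
  rw [this, MultilinearMap.map_smul_univ, Finset.prod_pow_eq_pow_sum]

lemma sum_degAfter_mul_add (e f : Fin s → ℕ) :
    ∑ l, degAfter e l * f l + ∑ l, degAfter f l * e l + ∑ l, e l * f l =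
      (∑ l, e l) * ∑ l, f l := by
  have h1 : ∑ l, degAfter e l * f l = ∑ k, ∑ l, if l < k then e k * f l else 0 := by
    rw [Finset.sum_comm]
    exact Finset.sum_congr rfl fun l _ => by rw [degAfter, Finset.sum_mul, Finset.sum_filter]
  have h2 : ∑ l, degAfter f l * e l = ∑ k, ∑ l, if k < l then e k * f l else 0 :=
    Finset.sum_congr rfl fun l _ => by
      rw [degAfter, Finset.sum_mul, Finset.sum_filter]
      exact Finset.sum_congr rfl fun k _ => by rw [mul_comm]
  have h3 : ∑ l, e l * f l = ∑ k, ∑ l, if k = l then e k * f l else 0 := by simp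
  rw [h1, h2, h3, Finset.sum_mul_sum, ← Finset.sum_add_distrib, ← Finset.sum_add_distrib]
  refine Finset.sum_congr rfl fun k _ => ?_
  rw [← Finset.sum_add_distrib, ← Finset.sum_add_distrib]
  refine Finset.sum_congr rfl fun l _ => ?_
  rcases lt_trichotomy k l with h | rfl | h
  · simp [h, h.not_gt, h.ne]
  · simp
  · simp [h, h.not_gt, h.ne']

lemma tprod_mul_tprod_comm (hA : SuperCommutative A) {e f : Fin s → ℕ} {a b : Fin s → A}
    (ha : ∀ l, IsHomog (e l) (a l)) (hb : ∀ l, IsHomog (f l) (b l)) :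
    tprod s A a * tprod s A b =
      (-1 : ℚ) ^ ((∑ l, e l) * ∑ l, f l) • (tprod s A b * tprod s A a) := by
  rw [mul_def, mul_def, mulLin_tprod_nat ha hb, mulLin_tprod_nat hb ha]
  have : (fun l => a l * b l) = fun l => (-1 : ℚ) ^ (e l * f l) • (b l * a l) :=
    funext fun l => hA (ha l) (hb l)
  rw [this, MultilinearMap.map_smul_univ, Finset.prod_pow_eq_pow_sum, smul_smul, smul_smul,
    ← pow_add, ← pow_add]
  congr 1
  apply neg_one_pow_congr
  rw [← sum_degAfter_mul_add]
  push_cast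
  linear_combination (-∑ x, (degAfter f x : ZMod 2) * e x) * (CharTwo.two_eq_zero (R := ZMod 2))

lemma part_tprod {e : Fin s → ℕ} {a : Fin s → A} (ha : ∀ l, IsHomog (e l) (a l)) (E : Fin 2) :
    part E (tprod s A a) = if (E : ℕ) = (∑ l, e l) % 2 then tprod s A a else 0 := by
  rw [part_of_isHomog (IsHomog_mod.mpr (isHomog_tprod ha)) E]
  simp only [Fin.ext_iff]

theorem superCommutative (hA : SuperCommutative A) :
    SuperCommutative (GradedTensorPower s A) := by
  -- Graded commutativity is a bilinear identity between the parts of two elements.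
  have key : ∀ (E F : Fin 2) (x y : GradedTensorPower s A), part E x * part F y =
      (-1 : ℚ) ^ ((E : ℕ) * F) • (part F y * part E x) := by
    intro E F x y
    suffices h : (LinearMap.lcomp ℚ _ (part F)) ∘ₗ (mulLin s A) ∘ₗ part E =
        (-1 : ℚ) ^ ((E : ℕ) * F) •
          (LinearMap.lcomp ℚ _ (part F)) ∘ₗ (mulLin s A).flip ∘ₗ part E from
      LinearMap.congr_fun (LinearMap.congr_fun h x) y
    refine hom_ext_homog fun e a ha => hom_ext_homog fun f b hb => ?_
    change part E (tprod s A a) * part F (tprod s A b) =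
      (-1 : ℚ) ^ ((E : ℕ) * F) • (part F (tprod s A b) * part E (tprod s A a))
    rw [part_tprod ha, part_tprod hb]
    split_ifs with h1 h2
    · rw [tprod_mul_tprod_comm hA ha hb, h1, h2]
      congr 1
      apply neg_one_pow_congr
      simp
    all_goals simp
  intro e f x y hx hy
  have hx' := part_of_isHomog (IsHomog_mod.mpr hx) ⟨e % 2, Nat.mod_lt _ two_pos⟩
  have hy' := part_of_isHomog (IsHomog_mod.mpr hy) ⟨f % 2, Nat.mod_lt _ two_pos⟩
  rw [if_pos rfl] at hx' hy'
  have := key ⟨e % 2, Nat.mod_lt _ two_pos⟩ ⟨f % 2, Nat.mod_lt _ two_pos⟩ x y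
  rw [hx', hy'] at this
  rw [this]
  congr 1
  apply neg_one_pow_congr
  simp

/-- No sign arises when all odd factors on the left stand at or before position `m` and the right
hand side is concentrated in position `m`. -/
lemma tprod_mul_single {e : Fin s → ℕ} {a : Fin s → A} (ha : ∀ l, IsHomog (e l) (a l))
    (m : Fin s) (he : ∀ l, m < l → e l = 0) (u : A) :
    tprod s A a * single m u = tprod s A (Function.update a m (a m * u)) := by
  rw [mul_def, single, mulLin_tprod (fun l => IsHomog_mod.mpr (ha l))]
  congr 1
  ext1 l
  by_cases hl : l = m
  · subst hl
    have : degAfter (fun k => e k % 2) l = 0 :=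
      Finset.sum_eq_zero fun k hk => by simp [he k (Finset.mem_filter.mp hk).2]
    simp [this]
  · have h1 : ∀ k, ((parity : A →ₐ[ℚ] A).toLinearMap ^ k) 1 = 1 := fun k => by
      simpa using (isHomog_one (A := A)).parity_pow k
    simp [hl, h1]

lemma isHomog_update_one {e : ℕ} {u : A} (hu : IsHomog e u) (k l : Fin s) :
    IsHomog (Function.update (fun _ => 0) k e l : ℕ)
      (Function.update (fun _ => (1 : A)) k u l) := by
  by_cases h : l = k
  · subst h; simpa using hu
  · simpa [h] using isHomog_one

lemma isHomog_single {e : ℕ} {u : A} (hu : IsHomog e u) (k : Fin s) :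
    IsHomog e (single k u) := by
  have := isHomog_tprod (isHomog_update_one hu k)
  rwa [Finset.sum_update_of_mem (Finset.mem_univ k), Finset.sum_const_zero, add_zero] at this

/-- The inclusion of the `k`-th factor as a homomorphism of algebras. -/
def singleHom (k : Fin s) : A →ₐ[ℚ] GradedTensorPower s A :=
  AlgHom.ofLinearMap ((tprod s A).toLinearMap (fun _ => 1) k)
    (by
      change tprod s A (Function.update (fun _ => 1) k 1) = _
      rw [show Function.update (fun _ => (1 : A)) k 1 = fun _ => 1 from Function.update_eq_self _ _,
        one_def])
    (by
      intro u v
      suffices h : ∀ e : Fin 2, (tprod s A).toLinearMap (fun _ => 1) k (part e u * v) =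
          (tprod s A).toLinearMap (fun _ => 1) k (part e u) *
            (tprod s A).toLinearMap (fun _ => 1) k v by
        conv_lhs => rw [← sum_part u, Finset.sum_mul, map_sum]
        conv_rhs => rw [← sum_part u, map_sum, Finset.sum_mul]
        exact Finset.sum_congr rfl fun e _ => h e
      intro e
      change tprod s A (Function.update (fun _ => 1) k _) =
        tprod s A (Function.update (fun _ => 1) k _) * single k v
      rw [tprod_mul_single (isHomog_update_one (isHomog_part e u) k) k
        fun l hl => by simp [hl.ne']]
      simp)

lemma single_mul (k : Fin s) (u v : A) :
    (single k (u * v) : GradedTensorPower s A) = single k u * single k v :=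
  map_mul (singleHom k) u v

lemma single_sub (k : Fin s) (u v : A) :
    (single k (u - v) : GradedTensorPower s A) = single k u - single k v :=
  map_sub (singleHom k) u v

lemma single_zero (k : Fin s) : (single k 0 : GradedTensorPower s A) = 0 :=
  map_zero (singleHom k)

lemma single_list_prod (k : Fin s) (L : List A) :
    (single k L.prod : GradedTensorPower s A) = (L.map (single k)).prod :=
  map_list_prod (singleHom k) L

/-- A pure tensor is the ordered product of its factors. -/
lemma tprod_eq_prod_single {e : Fin s → ℕ} {a : Fin s → A} (ha : ∀ l, IsHomog (e l) (a l)) :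
    tprod s A a = ((List.finRange s).map fun l => single l (a l)).prod := by
  suffices h : ∀ L : List (Fin s), L.Pairwise (· < ·) →
      (L.map fun l => single l (a l)).prod = tprod s A (fun l => if l ∈ L then a l else 1) by
    rw [h _ (List.pairwise_lt_finRange s)]
    simp
  intro L
  induction L using List.reverseRecOn with
  | nil => intro _; simp [one_def]
  | append_singleton L m ih =>
    intro hL
    rw [List.pairwise_append] at hL
    obtain ⟨hL, -, hm⟩ := hL
    have hm' : ∀ l, l ∈ L → l < m := fun l hl => hm l hl m (by simp)
    rw [List.map_append, List.prod_append, ih hL, List.map_singleton, List.prod_singleton,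
      tprod_mul_single (e := fun l => if l ∈ L then e l else 0)]
    · congr 1
      ext1 l
      by_cases hl : l = m
      · subst hl
        simp [show l ∉ L from fun h => (hm' l h).false]
      · simp [hl]
    · intro l
      by_cases hl : l ∈ L
      · simpa [hl] using ha l
      · simpa [hl] using isHomog_one
    · intro l hl
      exact if_neg fun h => (hm' l h).not_gt hl

omit [SuperAlgebra A] in
/-- Pure tensors are detected by functionals on the factors. -/
lemma tprod_apply_eq_one {a : Fin s → A} (f : Fin s → A →ₗ[ℚ] ℚ) (h : ∀ l, f l (a l) = 1) :
    liftLin ((MultilinearMap.mkPiAlgebra ℚ (Fin s) ℚ).compLinearMap f) (tprod s A a) = 1 := by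
  simp [h]

section Kernel

variable {B : Type*} [Ring B] [Algebra ℚ B] [SuperAlgebra B]

/-- An element in the kernel of the tensor power of a surjection `f` is annihilated by each pure
tensor whose factors annihilate the kernel of `f`. -/
lemma tprod_mul_eq_zero_of_map_eq_zero (f : A →ₐ[ℚ] B) (hf : ∀ a, f (parity a) = parity (f a))
    (hsurj : Function.Surjective f) {e : Fin s → ℕ} {η : Fin s → A}
    (hη : ∀ l, IsHomog (e l) (η l)) (hker : ∀ l z, f z = 0 → η l * z = 0)
    {z : GradedTensorPower s A} (hz : map s f hf z = 0) : tprod s A η * z = 0 := by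
  have hpar : ∀ (m : ℕ) (z : A), f z = 0 →
      f ((((parity : A →ₐ[ℚ] A).toLinearMap) ^ m) z) = 0 := by
    intro m
    induction m with
    | zero => intro z hz; simpa using hz
    | succ m ih =>
      intro z hz
      rw [pow_succ', Module.End.mul_apply, AlgHom.toLinearMap_apply, hf, ih z hz, map_zero]
  let m : Fin s → ℕ := degAfter (fun k => e k % 2)
  let F : Fin s → A →ₗ[ℚ] A := fun l =>
    LinearMap.mulLeft ℚ (η l) ∘ₗ ((parity : A →ₐ[ℚ] A).toLinearMap ^ (m l))
  -- Left multiplication by `tprod η` acts factorwise, and each of the actions factors over `B`.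
  have hG : ∀ l, ∃ G : B →ₗ[ℚ] A, G ∘ₗ f.toLinearMap = F l := by
    intro l
    obtain ⟨g, hg⟩ := f.toLinearMap.exists_rightInverse_of_surjective
      (LinearMap.range_eq_top.mpr hsurj)
    refine ⟨F l ∘ₗ g, ?_⟩
    ext z
    have h0 : F l (g (f z) - z) = 0 := by
      refine hker l _ (hpar _ _ ?_)
      have := LinearMap.congr_fun hg (f z)
      rw [map_sub, sub_eq_zero]
      exact this
    rw [map_sub, sub_eq_zero] at h0
    exact h0
  choose G hG using hG
  have hcomp : mulLin s A (tprod s A η) = mapLin G ∘ₗ (map s f hf).toLinearMap := by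
    refine hom_ext fun a => ?_
    rw [mulLin_tprod (fun l => IsHomog_mod.mpr (hη l)), LinearMap.comp_apply]
    change _ = mapLin G (mapLin _ (tprod s A a))
    rw [mapLin_tprod, mapLin_tprod]
    congr 1
    ext1 l
    exact (LinearMap.congr_fun (hG l) (a l)).symm
  rw [mul_def, hcomp, LinearMap.comp_apply, AlgHom.toLinearMap_apply, hz, map_zero]

end Kernel

section ZeroDivisors

lemma iteratedMul_single (k : Fin s) (u : A) : iteratedMul s A (single k u) = u := by
  rw [iteratedMul, single, liftLin_tprod, MultilinearMap.mkPiAlgebraFin_apply]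
  suffices h : ∀ L : List (Fin s), L.Nodup →
      (L.map (Function.update (fun _ => (1 : A)) k u)).prod = if k ∈ L then u else 1 by
    rw [List.ofFn_eq_map, h _ (List.nodup_finRange s), if_pos (List.mem_finRange k)]
  intro L hL
  induction L with
  | nil => simp
  | cons l L ih =>
    rw [List.nodup_cons] at hL
    rw [List.map_cons, List.prod_cons, ih hL.2]
    by_cases h : l = k
    · subst h; simp [hL.1]
    · simp [h, Ne.symm h]

lemma isZeroDivisor_diff (u : A) (l : Fin s) : IsZeroDivisor (diff u l) := by
  rw [IsZeroDivisor, diff, map_sub, iteratedMul_single, iteratedMul_single, sub_self]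

lemma map_single {B : Type*} [Ring B] [Algebra ℚ B] [SuperAlgebra B] (f : A →ₐ[ℚ] B)
    (hf : ∀ a, f (parity a) = parity (f a)) (k : Fin s) (u : A) :
    map s f hf (single k u) = single k (f u) := by
  change mapLin _ (tprod s A _) = _
  rw [mapLin_tprod, single]
  congr 1
  ext1 l
  by_cases h : l = k
  · subst h; simp
  · simp [h]

lemma map_diff {B : Type*} [Ring B] [Algebra ℚ B] [SuperAlgebra B] (f : A →ₐ[ℚ] B)
    (hf : ∀ a, f (parity a) = parity (f a)) (u : A) (l : Fin s) :
    map s f hf (diff u l) = diff (f u) l := by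
  rw [diff, map_sub, map_single, map_single, diff]

end ZeroDivisors

end GradedTensorPower

/-! ### The cohomology of a surface and of its cartesian powers -/

namespace HSurface

variable {g : ℕ}

lemma parity_def (z : HSurface g) :
    parity z = (⟨z.deg0, -z.coeffA, -z.coeffB, z.deg2⟩ : HSurface g) := rfl

lemma isHomog_one_iff (z : HSurface g) : IsHomog 1 z ↔ z.deg0 = 0 ∧ z.deg2 = 0 := by
  rw [IsHomog, parity_def, pow_one, neg_one_smul, HSurface.ext_iff]
  simp [self_eq_neg]

lemma isHomog_zero_iff (z : HSurface g) : IsHomog 0 z ↔ z.coeffA = 0 ∧ z.coeffB = 0 := by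
  rw [IsHomog, parity_def, pow_zero, one_smul, HSurface.ext_iff]
  simp [neg_eq_self]

theorem superCommutative : SuperCommutative (HSurface g) := by
  intro e f z w hz hw
  wlog h : e < 2 ∧ f < 2 generalizing e f
  · rw [this (e := e % 2) (f := f % 2) (IsHomog_mod.mpr hz) (IsHomog_mod.mpr hw)
      ⟨Nat.mod_lt _ two_pos, Nat.mod_lt _ two_pos⟩]
    congr 1
    apply GradedTensorPower.neg_one_pow_congr
    simp
  obtain ⟨he, hf⟩ := h
  interval_cases e <;> interval_cases f <;>
    simp only [isHomog_one_iff, isHomog_zero_iff] at hz hw <;> ext <;>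
    simp [hz.1, hz.2, hw.1, hw.2, mul_comm, add_comm]

lemma isHomog_a (p : Fin g) : IsHomog 1 (a p) := (isHomog_one_iff _).mpr ⟨rfl, rfl⟩

lemma isHomog_b (p : Fin g) : IsHomog 1 (b p) := (isHomog_one_iff _).mpr ⟨rfl, rfl⟩

lemma isHomog_omega : IsHomog 0 (omega : HSurface g) := (isHomog_zero_iff _).mpr ⟨rfl, rfl⟩

lemma a_mul_a (p q : Fin g) : a p * a q = 0 := by
  ext <;> simp [a]

lemma b_mul_b (p q : Fin g) : b p * b q = 0 := by
  ext <;> simp [b]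

lemma a_mul_b (p q : Fin g) : a p * b q = if p = q then omega else 0 := by
  split_ifs with h <;> ext <;> simp [a, b, omega, Pi.single_apply, h]
  simpa using Ne.symm h

lemma b_mul_a (p q : Fin g) : b p * a q = if p = q then -omega else 0 := by
  rw [superCommutative.odd_mul_odd (isHomog_b p) (isHomog_a q), a_mul_b]
  by_cases h : p = q
  · simp [h]
  · simp [h, Ne.symm h]

lemma omega_mul_a (p : Fin g) : omega * a p = 0 := by
  ext <;> simp [a, omega]

lemma omega_mul_b (p : Fin g) : omega * b p = 0 := by
  ext <;> simp [b, omega]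

/-- The coefficient of `ω`, as a linear functional. -/
def deg2Lin : HSurface g →ₗ[ℚ] ℚ where
  toFun := deg2
  map_add' _ _ := rfl
  map_smul' _ _ := rfl

end HSurface

section Power

variable {g n : ℕ}

lemma hPower_superCommutative : SuperCommutative (HPower g n) :=
  GradedTensorPower.superCommutative HSurface.superCommutative

lemma tensor_superCommutative {s : ℕ} : SuperCommutative (GradedTensorPower s (HPower g n)) :=
  GradedTensorPower.superCommutative hPower_superCommutative

lemma isHomog_a (i : Fin n) (p : Fin g) : IsHomog 1 (a i p) :=
  isHomog_single (HSurface.isHomog_a p) i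

lemma isHomog_b (i : Fin n) (p : Fin g) : IsHomog 1 (b i p) :=
  isHomog_single (HSurface.isHomog_b p) i

lemma isHomog_omega (i : Fin n) : IsHomog 0 (omega i : HPower g n) :=
  isHomog_single HSurface.isHomog_omega i

lemma isHomog_x (i : Fin n) (p : Fin g) : IsHomog 1 (x i p) := by
  unfold x
  split_ifs
  · exact (isHomog_a _ _).sub (isHomog_a _ _)
  · exact isHomog_a _ _

lemma isHomog_y (i : Fin n) (p : Fin g) : IsHomog 1 (y i p) := by
  unfold y
  split_ifs
  · exact (isHomog_b _ _).sub (isHomog_b _ _)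
  · exact isHomog_b _ _

lemma isHomog_diagonalClass (i j : Fin n) : IsHomog 0 (diagonalClass g i j) := by
  rw [IsHomog, pow_zero, one_smul, parity_diagonalClass]

lemma commute_of_even {u v : HPower g n} {e : ℕ} (hu : IsHomog 0 u) (hv : IsHomog e v) :
    u * v = v * u := by
  simpa using hPower_superCommutative hu hv

lemma a_mul_a (i : Fin n) (p q : Fin g) : a i p * a i q = 0 := by
  rw [a, a, ← single_mul, HSurface.a_mul_a, single_zero]

lemma b_mul_b (i : Fin n) (p q : Fin g) : b i p * b i q = 0 := by
  rw [b, b, ← single_mul, HSurface.b_mul_b, single_zero]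

lemma a_mul_b (i : Fin n) (p q : Fin g) : a i p * b i q = if p = q then omega i else 0 := by
  rw [a, b, ← single_mul, HSurface.a_mul_b]
  split_ifs
  · rfl
  · exact single_zero i

lemma b_mul_a (i : Fin n) (p q : Fin g) : b i p * a i q = if p = q then -omega i else 0 := by
  rw [hPower_superCommutative.odd_mul_odd (isHomog_b i p) (isHomog_a i q), a_mul_b]
  by_cases h : p = q
  · simp [h]
  · simp [h, Ne.symm h]

lemma omega_mul_a (i : Fin n) (p : Fin g) : omega i * a i p = 0 := by
  rw [a, omega, ← single_mul, HSurface.omega_mul_a, single_zero]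

lemma omega_mul_b (i : Fin n) (p : Fin g) : omega i * b i p = 0 := by
  rw [b, omega, ← single_mul, HSurface.omega_mul_b, single_zero]

/-- Restricted to the diagonal, the classes `a_i(q)` and `a_j(q)` agree. -/
lemma diagonalClass_mul_a_sub_a (i j : Fin n) (q : Fin g) :
    diagonalClass g i j * (a i q - a j q) = 0 := by
  have hterm : ∀ p : Fin g, (b i p * a j p - a i p * b j p) * (a i q - a j q) =
      if p = q then omega i * a j q - a i q * omega j else 0 := by
    intro p
    have h1 : b i p * a j p * a i q = if p = q then omega i * a j q else 0 := by
      rw [mul_assoc, hPower_superCommutative.odd_mul_odd (isHomog_a j p) (isHomog_a i q), mul_neg,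
        ← mul_assoc, b_mul_a]
      split_ifs with h <;> simp [h]
    have h2 : b i p * a j p * a j q = 0 := by rw [mul_assoc, a_mul_a, mul_zero]
    have h3 : a i p * b j p * a i q = 0 := by
      rw [mul_assoc, hPower_superCommutative.odd_mul_odd (isHomog_b j p) (isHomog_a i q), mul_neg,
        ← mul_assoc, a_mul_a, zero_mul, neg_zero]
    have h4 : a i p * b j p * a j q = if p = q then -(a i q * omega j) else 0 := by
      rw [mul_assoc, b_mul_a]
      split_ifs with h <;> simp [h]
    rw [sub_mul, mul_sub, mul_sub, h1, h2, h3, h4]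
    split_ifs <;> abel
  rw [diagonalClass, add_mul, Finset.sum_mul, Finset.sum_congr rfl fun p _ => hterm p,
    Finset.sum_ite_eq' Finset.univ q, if_pos (Finset.mem_univ q), add_mul, mul_sub, mul_sub,
    omega_mul_a, omega_mul_a, commute_of_even (isHomog_omega j) (isHomog_a i q)]
  abel

/-- Restricted to the diagonal, the classes `b_i(q)` and `b_j(q)` agree. -/
lemma diagonalClass_mul_b_sub_b (i j : Fin n) (q : Fin g) :
    diagonalClass g i j * (b i q - b j q) = 0 := by
  have hterm : ∀ p : Fin g, (b i p * a j p - a i p * b j p) * (b i q - b j q) =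
      if p = q then omega i * b j q - b i q * omega j else 0 := by
    intro p
    have h1 : b i p * a j p * b i q = 0 := by
      rw [mul_assoc, hPower_superCommutative.odd_mul_odd (isHomog_a j p) (isHomog_b i q), mul_neg,
        ← mul_assoc, b_mul_b, zero_mul, neg_zero]
    have h2 : b i p * a j p * b j q = if p = q then b i q * omega j else 0 := by
      rw [mul_assoc, a_mul_b]
      split_ifs with h <;> simp [h]
    have h3 : a i p * b j p * b i q = if p = q then -(omega i * b j q) else 0 := by
      rw [mul_assoc, hPower_superCommutative.odd_mul_odd (isHomog_b j p) (isHomog_b i q), mul_neg,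
        ← mul_assoc, a_mul_b]
      split_ifs with h <;> simp [h]
    have h4 : a i p * b j p * b j q = 0 := by rw [mul_assoc, b_mul_b, mul_zero]
    rw [sub_mul, mul_sub, mul_sub, h1, h2, h3, h4]
    split_ifs <;> abel
  rw [diagonalClass, add_mul, Finset.sum_mul, Finset.sum_congr rfl fun p _ => hterm p,
    Finset.sum_ite_eq' Finset.univ q, if_pos (Finset.mem_univ q), add_mul, mul_sub, mul_sub,
    omega_mul_b, omega_mul_b, commute_of_even (isHomog_omega j) (isHomog_b i q)]
  abel

/-! ### Classes that annihilate the ideal of the diagonals -/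

/-- The differences `u_i - u_1` for `i ≥ 2` (in the numbering from `1`). -/
def differences (u : Fin n → HPower g n) : List (HPower g n) :=
  ((List.finRange n).tail.map fun i => u i - u ⟨0, i.pos⟩)

lemma isHomog_of_mem_differences {u : Fin n → HPower g n} (hu : ∀ i, IsHomog 1 (u i)) :
    ∀ v ∈ differences u, IsHomog 1 v := by
  intro v hv
  obtain ⟨i, -, rfl⟩ := List.mem_map.mp hv
  exact (hu _).sub (hu _)

lemma mem_tail_finRange {m : ℕ} {i : Fin m} : i ∈ (List.finRange m).tail ↔ (i : ℕ) ≠ 0 := by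
  cases m with
  | zero => exact i.elim0
  | succ m =>
    rw [List.finRange_succ, List.tail_cons, List.mem_map]
    constructor
    · rintro ⟨k, -, rfl⟩; simp
    · intro h
      exact ⟨i.pred (fun h0 => h (by simp [h0])), List.mem_finRange _, Fin.succ_pred _ _⟩

/-- The product of the differences `u_i - u_1` contains, up to sign, each `u_i - u_j` as a factor;
so it is annihilated by the diagonal classes if all the products `d_{ij} (u_i - u_j)` vanish. -/
lemma diagonalClass_mul_prod_differences {u : Fin n → HPower g n} (hu : ∀ i, IsHomog 1 (u i))
    (h0 : ∀ i j, diagonalClass g i j * (u i - u j) = 0) {i j : Fin n} (hij : i < j) :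
    diagonalClass g i j * (differences u).prod = 0 := by
  have hL := isHomog_of_mem_differences hu
  have hn : 0 < n := i.pos
  have hj : j ∈ (List.finRange n).tail := mem_tail_finRange.mpr (by
    have : (i : ℕ) < j := hij
    omega)
  have hnd : (List.finRange n).tail.Nodup := (List.nodup_finRange n).tail
  have hp : (differences u).Perm ((u j - u ⟨0, hn⟩) ::
      (((List.finRange n).tail.erase j).map fun i => u i - u ⟨0, i.pos⟩)) :=
    (List.perm_cons_erase hj).map _
  refine hPower_superCommutative.mul_prod_eq_zero hL hp (z := u j - u i) ?_ ?_
  · rw [sub_sub_sub_cancel_left]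
    by_cases hi : (i : ℕ) = 0
    · rw [show i = ⟨0, hn⟩ from Fin.ext hi, sub_self]
      exact zero_mem _
    · refine Submodule.subset_span (List.mem_map.mpr ⟨i, ?_, rfl⟩)
      rw [hnd.mem_erase_iff]
      exact ⟨hij.ne, mem_tail_finRange.mpr hi⟩
  · rw [← neg_sub, mul_neg, h0, neg_zero]

/-- By graded commutativity, the annihilator of a homogeneous element is a two-sided ideal. -/
lemma mul_eq_zero_of_toEInfty_eq_zero {e : ℕ} {η : HPower g n} (hη : IsHomog e η)
    (h : ∀ i j, i < j → diagonalClass g i j * η = 0) {z : HPower g n} (hz : toEInfty g n z = 0) :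
    η * z = 0 := by
  have hmove : ∀ r w : HPower g n, η * w = 0 → η * (r * w) = 0 := by
    intro r w hw
    rw [← sum_part r, Finset.sum_mul, Finset.mul_sum]
    refine Finset.sum_eq_zero fun k _ => ?_
    rw [← mul_assoc, hPower_superCommutative hη (isHomog_part k r), smul_mul_assoc, mul_assoc, hw,
      mul_zero, smul_zero]
  let I : TwoSidedIdeal (HPower g n) := TwoSidedIdeal.mk' {w | η * w = 0} (mul_zero η)
    (fun {u v} hu hv => by
      change η * (u + v) = 0
      rw [mul_add, show η * u = 0 from hu, show η * v = 0 from hv, add_zero])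
    (fun {u} hu => by
      change η * -u = 0
      rw [mul_neg, show η * u = 0 from hu, neg_zero])
    (fun {u v} hv => hmove u v hv)
    (fun {u v} hu => by
      change η * (u * v) = 0
      rw [← mul_assoc, show η * u = 0 from hu, zero_mul])
  have hI : ∀ w, w ∈ I ↔ η * w = 0 := fun w => TwoSidedIdeal.mem_mk' _ _ _ _ _ _ _
  have hle : TwoSidedIdeal.span {d | ∃ i j : Fin n, i < j ∧ d = diagonalClass g i j} ≤ I := by
    rw [TwoSidedIdeal.span_le]
    rintro _ ⟨i, j, hij, rfl⟩
    rw [SetLike.mem_coe, hI, ← commute_of_even (isHomog_diagonalClass i j) hη]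
    exact h i j hij
  have hz' : z ∈ idealD g n := Ideal.Quotient.eq_zero_iff_mem.mp hz
  exact (hI z).mp (hle hz')

end Power

/-! ### The product of zero-divisors as a product of odd elements -/

section Lists

lemma list_prod_flatMap {α M : Type*} [Monoid M] (L : List α) (f : α → List M) :
    (L.flatMap f).prod = (L.map fun i => (f i).prod).prod := by
  rw [List.flatMap_def, List.prod_flatten, List.map_map]
  rfl

lemma mem_tail_dropLast_finRange {m : ℕ} {i : Fin m} (h0 : (i : ℕ) ≠ 0) (h1 : (i : ℕ) ≠ m - 1) :
    i ∈ (List.finRange m).tail.dropLast := by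
  have hi := i.2
  obtain ⟨m, rfl⟩ : ∃ k, m = k + 2 := ⟨m - 2, by omega⟩
  rw [List.finRange_succ, List.tail_cons, List.finRange_succ_last, List.map_append,
    List.map_singleton, List.dropLast_concat, List.map_map]
  refine List.mem_map.mpr ⟨⟨i - 1, by omega⟩, List.mem_finRange _, Fin.ext ?_⟩
  simp
  omega

end Lists

section Factors

variable {g n s : ℕ}

/-- The linear forms whose product annihilates the diagonal classes in position `l`: the
differences of the `b_i(1)`, and in the last position those of the `a_i(1)`. -/
def annihilatorList (s n : ℕ) (hg : 1 ≤ g) (l : Fin s) : List (HPower g n) :=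
  differences fun i => if (l : ℕ) = s - 1 then a i (⟨0, hg⟩ : Fin g) else b i (⟨0, hg⟩ : Fin g)

/-- The pure tensor with the annihilating products as factors. -/
def annihilator (s n : ℕ) (hg : 1 ≤ g) : GradedTensorPower s (HPower g n) :=
  tprod s (HPower g n) fun l => (annihilatorList s n hg l).prod

/-- The factors of `prodY1`. -/
def prodY1List (s : ℕ) (hg : 1 ≤ g) (hn : 1 ≤ n) : List (GradedTensorPower s (HPower g n)) :=
  (List.finRange s).tail.dropLast.map (diff (y (⟨0, hn⟩ : Fin n) (⟨0, hg⟩ : Fin g)))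

/-- The factors of `prodXY`. -/
def prodXYList (hs : 2 ≤ s) (n : ℕ) (hg : 1 ≤ g) : List (GradedTensorPower s (HPower g n)) :=
  (List.finRange n).flatMap fun i =>
    (List.finRange s).tail.map (diff (x i (⟨0, hg⟩ : Fin g))) ++ [tilde hs (y i (⟨0, hg⟩ : Fin g))]

/-- The factors of `annihilator * (prodY1 * prodXY)`. -/
def factors (hs : 2 ≤ s) (hg : 1 ≤ g) (hn : 1 ≤ n) : List (GradedTensorPower s (HPower g n)) :=
  ((List.finRange s).flatMap fun l => (annihilatorList s n hg l).map (single l)) ++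
    (prodY1List s hg hn ++ prodXYList hs n hg)

lemma isHomog_of_mem_annihilatorList (hg : 1 ≤ g) (l : Fin s) :
    ∀ u ∈ annihilatorList s n hg l, IsHomog 1 u := by
  refine isHomog_of_mem_differences fun i => ?_
  split_ifs
  · exact isHomog_a _ _
  · exact isHomog_b _ _

lemma annihilator_mul_eq_zero (hg : 1 ≤ g) {z : GradedTensorPower s (HPower g n)}
    (hz : imageInE g n s z = 0) : annihilator s n hg * z = 0 := by
  refine tprod_mul_eq_zero_of_map_eq_zero (toEInfty g n) (fun _ => rfl)
    Ideal.Quotient.mk_surjective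
    (fun l => isHomog_list_prod (isHomog_of_mem_annihilatorList hg l)) (fun l w hw => ?_) hz
  refine mul_eq_zero_of_toEInfty_eq_zero
    (isHomog_list_prod (isHomog_of_mem_annihilatorList hg l)) (fun i j hij => ?_) hw
  refine diagonalClass_mul_prod_differences (fun i => ?_) (fun i j => ?_) hij
  · split_ifs
    · exact isHomog_a _ _
    · exact isHomog_b _ _
  · split_ifs
    · exact diagonalClass_mul_a_sub_a _ _ _
    · exact diagonalClass_mul_b_sub_b _ _ _

lemma prodY1List_prod (hg : 1 ≤ g) (hn : 1 ≤ n) :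
    (prodY1List s hg hn).prod = prodY1 s hg hn := rfl

lemma prodXYList_prod (hs : 2 ≤ s) (hg : 1 ≤ g) :
    (prodXYList hs n hg).prod = prodXY hs n hg := by
  rw [prodXYList, list_prod_flatMap, prodXY]
  simp only [List.prod_append, List.prod_singleton, bar]

lemma factors_prod (hs : 2 ≤ s) (hg : 1 ≤ g) (hn : 1 ≤ n) :
    (factors hs hg hn).prod = annihilator s n hg * (prodY1 s hg hn * prodXY hs n hg) := by
  rw [factors, List.prod_append, List.prod_append, prodXYList_prod, prodY1List_prod, annihilator,
    tprod_eq_prod_single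
      (fun l => isHomog_list_prod (isHomog_of_mem_annihilatorList hg l)), list_prod_flatMap]
  simp only [single_list_prod]

lemma isHomog_diff {u : HPower g n} {e : ℕ} (hu : IsHomog e u) (l : Fin s) :
    IsHomog e (diff u l) :=
  (isHomog_single hu _).sub (isHomog_single hu _)

lemma isHomog_of_mem_factors (hs : 2 ≤ s) (hg : 1 ≤ g) (hn : 1 ≤ n) :
    ∀ u ∈ factors hs hg hn, IsHomog 1 u := by
  intro u hu
  simp only [factors, prodY1List, prodXYList, List.mem_append, List.mem_flatMap, List.mem_map,
    List.mem_singleton] at hu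
  rcases hu with ⟨l, -, v, hv, rfl⟩ | ⟨l, -, rfl⟩ | ⟨i, -, ⟨l, -, rfl⟩ | rfl⟩
  · exact isHomog_single (isHomog_of_mem_annihilatorList hg l v hv) l
  · exact isHomog_diff (isHomog_y _ _) _
  · exact isHomog_diff (isHomog_x _ _) _
  · exact isHomog_diff (isHomog_y _ _) _

lemma length_prodY1List (hg : 1 ≤ g) (hn : 1 ≤ n) : (prodY1List s hg hn).length = s - 2 := by
  simp only [prodY1List, List.length_map, List.length_dropLast, List.length_tail,
    List.length_finRange]
  omega

lemma length_prodXYList (hs : 2 ≤ s) (hg : 1 ≤ g) : (prodXYList hs n hg).length = n * s := by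
  simp only [prodXYList, List.length_flatMap, List.length_append, List.length_map,
    List.length_tail, List.length_finRange, List.length_singleton, List.map_const',
    List.sum_replicate, smul_eq_mul]
  congr 1
  omega

lemma length_factors (hs : 2 ≤ s) (hg : 1 ≤ g) (hn : 1 ≤ n) :
    (factors hs hg hn).length + 2 = s * (n * 2) := by
  rw [factors, List.length_append, List.length_append, length_prodY1List, length_prodXYList]
  simp only [List.length_flatMap, List.length_map, annihilatorList, differences,
    List.length_tail, List.length_finRange, List.map_const', List.sum_replicate, smul_eq_mul]
  obtain ⟨n, rfl⟩ : ∃ k, n = k + 1 := ⟨n - 1, by omega⟩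
  obtain ⟨s, rfl⟩ : ∃ k, s = k + 2 := ⟨s - 2, by omega⟩
  simp only [Nat.add_sub_cancel]
  ring

lemma single_annihilator_mem_factors (hs : 2 ≤ s) (hg : 1 ≤ g) (hn : 1 ≤ n) (l : Fin s)
    {i : Fin n} (hi : (i : ℕ) ≠ 0) :
    single l ((if (l : ℕ) = s - 1 then a i (⟨0, hg⟩ : Fin g) else b i (⟨0, hg⟩ : Fin g)) -
      (if (l : ℕ) = s - 1 then a (⟨0, hn⟩ : Fin n) (⟨0, hg⟩ : Fin g)
        else b (⟨0, hn⟩ : Fin n) (⟨0, hg⟩ : Fin g))) ∈ factors hs hg hn := by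
  refine List.mem_append_left _ (List.mem_flatMap.mpr ⟨l, List.mem_finRange l, ?_⟩)
  exact List.mem_map_of_mem (List.mem_map.mpr ⟨i, mem_tail_finRange.mpr hi, rfl⟩)

lemma diff_x_mem_factors (hs : 2 ≤ s) (hg : 1 ≤ g) (hn : 1 ≤ n) (i : Fin n) {l : Fin s}
    (hl : (l : ℕ) ≠ 0) : diff (x i (⟨0, hg⟩ : Fin g)) l ∈ factors hs hg hn := by
  refine List.mem_append_right _ (List.mem_append_right _
    (List.mem_flatMap.mpr ⟨i, List.mem_finRange i, List.mem_append_left _ ?_⟩))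
  exact List.mem_map_of_mem (mem_tail_finRange.mpr hl)

lemma diff_y_last_mem_factors (hs : 2 ≤ s) (hg : 1 ≤ g) (hn : 1 ≤ n) (i : Fin n) {l : Fin s}
    (hl : (l : ℕ) = s - 1) : diff (y i (⟨0, hg⟩ : Fin g)) l ∈ factors hs hg hn := by
  refine List.mem_append_right _ (List.mem_append_right _
    (List.mem_flatMap.mpr ⟨i, List.mem_finRange i, List.mem_append_right _ ?_⟩))
  rw [List.mem_singleton, tilde]
  congr 1
  exact Fin.ext hl

lemma diff_y_first_mem_factors (hs : 2 ≤ s) (hg : 1 ≤ g) (hn : 1 ≤ n) {l : Fin s}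
    (hl : (l : ℕ) ≠ 0) :
    diff (y (⟨0, hn⟩ : Fin n) (⟨0, hg⟩ : Fin g)) l ∈ factors hs hg hn := by
  by_cases h : (l : ℕ) = s - 1
  · exact diff_y_last_mem_factors hs hg hn _ h
  · exact List.mem_append_right _ (List.mem_append_left _
      (List.mem_map_of_mem (mem_tail_dropLast_finRange hl h)))

lemma x_first (hg : 1 ≤ g) (hn : 1 ≤ n) :
    x (⟨0, hn⟩ : Fin n) (⟨0, hg⟩ : Fin g) = a ⟨0, hn⟩ ⟨0, hg⟩ := by simp [x]

lemma y_first (hg : 1 ≤ g) (hn : 1 ≤ n) :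
    y (⟨0, hn⟩ : Fin n) (⟨0, hg⟩ : Fin g) = b ⟨0, hn⟩ ⟨0, hg⟩ := by simp [y]

lemma x_of_ne (hg : 1 ≤ g) (hn : 1 ≤ n) {i : Fin n} (hi : (i : ℕ) ≠ 0) :
    x i (⟨0, hg⟩ : Fin g) = a i ⟨0, hg⟩ - a ⟨0, hn⟩ ⟨0, hg⟩ := by simp [x, hi]

lemma y_of_ne (hg : 1 ≤ g) (hn : 1 ≤ n) {i : Fin n} (hi : (i : ℕ) ≠ 0) :
    y i (⟨0, hg⟩ : Fin g) = b i ⟨0, hg⟩ - b ⟨0, hn⟩ ⟨0, hg⟩ := by simp [y, hi]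

/-- Together with `a_1(1)` and `b_1(1)` in the first position, the factors span all the classes
`a_i(1)` and `b_i(1)` in all positions. -/
lemma single_mem_of_factors_subset (hs : 2 ≤ s) (hg : 1 ≤ g) (hn : 1 ≤ n)
    (S : Submodule ℚ (GradedTensorPower s (HPower g n)))
    (ha : single (⟨0, by omega⟩ : Fin s) (a (⟨0, hn⟩ : Fin n) (⟨0, hg⟩ : Fin g)) ∈ S)
    (hb : single (⟨0, by omega⟩ : Fin s) (b (⟨0, hn⟩ : Fin n) (⟨0, hg⟩ : Fin g)) ∈ S)
    (hS : ∀ u ∈ factors hs hg hn, u ∈ S) (l : Fin s) (i : Fin n) :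
    single l (a i (⟨0, hg⟩ : Fin g)) ∈ S ∧ single l (b i (⟨0, hg⟩ : Fin g)) ∈ S := by
  have hs0 : 0 < s := by omega
  -- The difference in position `l` identifies membership in position `l` and in the first one.
  have hdiff : ∀ (u : HPower g n) (l : Fin s), diff u l ∈ S →
      (single l u ∈ S ↔ single (⟨0, hs0⟩ : Fin s) u ∈ S) := by
    intro u l h
    rw [diff] at h
    constructor
    · intro h'; simpa using add_mem h h'
    · intro h'; simpa using sub_mem h' h
  have hsub : ∀ (u v : HPower g n) (l : Fin s), single l v ∈ S →
      (single l (u - v) ∈ S ↔ single l u ∈ S) := by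
    intro u v l hv
    rw [single_sub]
    exact Submodule.sub_mem_iff_left _ hv
  have ha0 : ∀ l : Fin s, single l (a (⟨0, hn⟩ : Fin n) (⟨0, hg⟩ : Fin g)) ∈ S := by
    intro l
    by_cases hl : (l : ℕ) = 0
    · rwa [show l = ⟨0, hs0⟩ from Fin.ext hl]
    · refine (hdiff _ l ?_).mpr ha
      rw [← x_first]
      exact hS _ (diff_x_mem_factors hs hg hn _ hl)
  have hb0 : ∀ l : Fin s, single l (b (⟨0, hn⟩ : Fin n) (⟨0, hg⟩ : Fin g)) ∈ S := by
    intro l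
    by_cases hl : (l : ℕ) = 0
    · rwa [show l = ⟨0, hs0⟩ from Fin.ext hl]
    · refine (hdiff _ l ?_).mpr hb
      rw [← y_first]
      exact hS _ (diff_y_first_mem_factors hs hg hn hl)
  by_cases hi : (i : ℕ) = 0
  · rw [show i = ⟨0, hn⟩ from Fin.ext hi]
    exact ⟨ha0 l, hb0 l⟩
  have hbl : ∀ l : Fin s, (l : ℕ) ≠ s - 1 → single l (b i (⟨0, hg⟩ : Fin g)) ∈ S := by
    intro l hl
    have := hS _ (single_annihilator_mem_factors hs hg hn l hi)
    rw [if_neg hl, if_neg hl] at this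
    exact (hsub _ _ l (hb0 l)).mp this
  have hlast : ∀ l : Fin s, (l : ℕ) = s - 1 → single l (a i (⟨0, hg⟩ : Fin g)) ∈ S := by
    intro l hl
    have := hS _ (single_annihilator_mem_factors hs hg hn l hi)
    rw [if_pos hl, if_pos hl] at this
    exact (hsub _ _ l (ha0 l)).mp this
  have hx : ∀ l : Fin s, single l (x i (⟨0, hg⟩ : Fin g)) ∈ S ↔
      single l (a i (⟨0, hg⟩ : Fin g)) ∈ S := fun l => by
    rw [x_of_ne hg hn hi, hsub _ _ l (ha0 l)]
  have hy : ∀ l : Fin s, single l (y i (⟨0, hg⟩ : Fin g)) ∈ S ↔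
      single l (b i (⟨0, hg⟩ : Fin g)) ∈ S := fun l => by
    rw [y_of_ne hg hn hi, hsub _ _ l (hb0 l)]
  constructor
  · by_cases hl : (l : ℕ) = s - 1
    · exact hlast l hl
    -- The last position reaches the first one, which reaches all others.
    have h0 : single (⟨0, hs0⟩ : Fin s) (x i (⟨0, hg⟩ : Fin g)) ∈ S :=
      (hdiff _ ⟨s - 1, by omega⟩ (hS _ (diff_x_mem_factors hs hg hn i
        (by change s - 1 ≠ 0; omega)))).mp ((hx _).mpr (hlast _ rfl))
    by_cases hl0 : (l : ℕ) = 0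
    · rw [show l = ⟨0, hs0⟩ from Fin.ext hl0]
      exact (hx _).mp h0
    · exact (hx _).mp ((hdiff _ l (hS _ (diff_x_mem_factors hs hg hn i hl0))).mpr h0)
  · by_cases hl : (l : ℕ) = s - 1
    · refine (hy l).mp ((hdiff _ l (hS _ (diff_y_last_mem_factors hs hg hn i hl))).mpr
        ((hy _).mpr (hbl _ ?_)))
      change 0 ≠ s - 1
      omega
    · exact hbl l hl

/-- The product of all the classes `a_i(1)` and `b_i(1)` in all positions is the fundamental
class of `(Σ_g^{×n})^{×s}`. -/
lemma tprod_omega_ne_zero :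
    tprod s (HPower g n) (fun _ => tprod n (HSurface g) fun _ => HSurface.omega) ≠ 0 := by
  let f : HPower g n →ₗ[ℚ] ℚ := liftLin
    ((MultilinearMap.mkPiAlgebra ℚ (Fin n) ℚ).compLinearMap fun _ => HSurface.deg2Lin)
  intro h
  have h1 := tprod_apply_eq_one (s := s) (a := fun _ : Fin s =>
    tprod n (HSurface g) fun _ => HSurface.omega) (fun _ => f) fun _ =>
      tprod_apply_eq_one (fun _ => HSurface.deg2Lin) fun _ => rfl
  rw [h, map_zero] at h1
  exact zero_ne_one h1

/-- All the classes `a_i(1)` and `b_i(1)` in all positions. -/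
def allClasses (s n : ℕ) (hg : 1 ≤ g) : List (GradedTensorPower s (HPower g n)) :=
  (List.finRange s).flatMap fun l => (List.finRange n).flatMap fun i =>
    [single l (a i (⟨0, hg⟩ : Fin g)), single l (b i (⟨0, hg⟩ : Fin g))]

lemma allClasses_prod (hg : 1 ≤ g) : (allClasses s n hg).prod =
    tprod s (HPower g n) (fun _ => tprod n (HSurface g) fun _ => HSurface.omega) := by
  have h1 : ∀ l : Fin s, IsHomog (∑ _ : Fin n, 0)
      (tprod n (HSurface g) fun _ => HSurface.omega) := fun _ =>
    isHomog_tprod fun _ => HSurface.isHomog_omega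
  rw [tprod_eq_prod_single h1, allClasses, list_prod_flatMap,
    tprod_eq_prod_single (s := n) fun _ => HSurface.isHomog_omega]
  simp only [list_prod_flatMap, single_list_prod, List.map_map, List.prod_cons, List.prod_nil,
    mul_one, ← single_mul, a_mul_b, if_true]
  rfl

/-- The class `ω_1 = a_1(1) b_1(1)` in the first position supplies the two linear forms that the
list of factors lacks for a basis of the span of all the classes `a_i(1)` and `b_i(1)`. -/
theorem single_mul_factors_prod_ne_zero (hs : 2 ≤ s) (hg : 1 ≤ g) (hn : 1 ≤ n) :
    single (⟨0, by omega⟩ : Fin s) (omega (⟨0, hn⟩ : Fin n) : HPower g n) *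
      (factors hs hg hn).prod ≠ 0 := by
  have hω : (omega (⟨0, hn⟩ : Fin n) : HPower g n) = a ⟨0, hn⟩ ⟨0, hg⟩ * b ⟨0, hn⟩ ⟨0, hg⟩ := by
    rw [a_mul_b, if_pos rfl]
  have h := tensor_superCommutative.prod_ne_zero_of_mem_span (L₁ := allClasses s n hg)
    (L₂ := single (⟨0, by omega⟩ : Fin s) (a (⟨0, hn⟩ : Fin n) (⟨0, hg⟩ : Fin g)) ::
      single (⟨0, by omega⟩ : Fin s) (b (⟨0, hn⟩ : Fin n) (⟨0, hg⟩ : Fin g)) ::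
        factors hs hg hn) ?_ ?_ ?_ (allClasses_prod hg ▸ tprod_omega_ne_zero)
  · rwa [List.prod_cons, List.prod_cons, ← mul_assoc, ← single_mul, ← hω] at h
  · intro u hu
    rw [List.mem_cons, List.mem_cons] at hu
    rcases hu with rfl | rfl | hu
    · exact isHomog_single (isHomog_a _ _) _
    · exact isHomog_single (isHomog_b _ _) _
    · exact isHomog_of_mem_factors hs hg hn u hu
  · rw [List.length_cons, List.length_cons, add_assoc, length_factors, allClasses]
    simp [List.length_flatMap]
  · intro u hu
    simp only [allClasses, List.mem_flatMap, List.mem_cons, List.not_mem_nil, or_false] at hu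
    obtain ⟨l, -, i, -, hu⟩ := hu
    have := single_mem_of_factors_subset hs hg hn (Submodule.span ℚ _)
      (Submodule.subset_span List.mem_cons_self)
      (Submodule.subset_span (List.mem_cons_of_mem _ List.mem_cons_self))
      (fun u hu => Submodule.subset_span
        (List.mem_cons_of_mem _ (List.mem_cons_of_mem _ hu))) l i
    rcases hu with rfl | rfl
    · exact this.1
    · exact this.2

/-! ### The factors `c` and `d` -/

/-- The factors `δ_l(a_1(1))` for different `l` stand at different places of the list. -/
lemma exists_factors_perm_diff_a (hs : 2 ≤ s) (hg : 1 ≤ g) (hn : 1 ≤ n) {k : Fin s}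
    (hk : (k : ℕ) ≠ 0) : ∃ L : List (GradedTensorPower s (HPower g n)),
      (factors hs hg hn).Perm (diff (a (⟨0, hn⟩ : Fin n) (⟨0, hg⟩ : Fin g)) k :: L) ∧
      ∀ l : Fin s, (l : ℕ) ≠ 0 → l ≠ k →
        diff (a (⟨0, hn⟩ : Fin n) (⟨0, hg⟩ : Fin g)) l ∈ L := by
  have hR : ∃ R, (factors hs hg hn).Perm
      ((List.finRange s).tail.map (diff (a (⟨0, hn⟩ : Fin n) (⟨0, hg⟩ : Fin g))) ++ R) := by
    obtain ⟨n, rfl⟩ : ∃ m, n = m + 1 := ⟨n - 1, by omega⟩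
    rw [factors, prodXYList, List.finRange_succ, List.flatMap_cons, ← x_first hg hn,
      ← List.append_assoc, List.append_assoc _ [_]]
    exact ⟨_, (List.perm_append_comm_assoc _ _ _)⟩
  obtain ⟨R, hR⟩ := hR
  have hnd : (List.finRange s).tail.Nodup := (List.nodup_finRange s).tail
  refine ⟨((List.finRange s).tail.erase k).map
    (diff (a (⟨0, hn⟩ : Fin n) (⟨0, hg⟩ : Fin g))) ++ R, hR.trans ?_, fun l hl hlk => ?_⟩
  · exact ((List.perm_cons_erase (mem_tail_finRange.mpr hk)).map _).append_right R
  · exact List.mem_append_left _ (List.mem_map_of_mem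
      (hnd.mem_erase_iff.mpr ⟨hlk, mem_tail_finRange.mpr hl⟩))

/-- The class `a_1(2)` in one position times `b_1(2)` in another kills `a_1(1)` in both positions,
but the difference of the latter is a factor of the product, up to the other factors. -/
lemma single_a_mul_single_b_mul_factors_prod (hs : 2 ≤ s) (hg : 2 ≤ g) (hn : 1 ≤ n) {k l : Fin s}
    (hkl : k ≠ l) :
    single k (a (⟨0, hn⟩ : Fin n) (⟨1, hg⟩ : Fin g)) *
      single l (b (⟨0, hn⟩ : Fin n) (⟨1, hg⟩ : Fin g)) *
        (factors hs (one_le_two.trans hg) hn).prod = 0 := by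
  have hg1 : 1 ≤ g := one_le_two.trans hg
  have hodd := isHomog_of_mem_factors hs hg1 hn
  set α := a (⟨0, hn⟩ : Fin n) (⟨0, hg1⟩ : Fin g) with hα
  set u := a (⟨0, hn⟩ : Fin n) (⟨1, hg⟩ : Fin g) with hu
  set v := b (⟨0, hn⟩ : Fin n) (⟨1, hg⟩ : Fin g) with hv
  have huα : u * α = 0 := a_mul_a _ _ _
  have hvα : v * α = 0 := by rw [hv, hα, b_mul_a, if_neg (by simp [Fin.ext_iff])]
  have hkill : (single k u : GradedTensorPower s (HPower g n)) * single l v *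
      (single k α - single l α) = 0 := by
    rw [mul_sub, mul_assoc, mul_assoc, ← single_mul l, hvα, single_zero, mul_zero, sub_zero,
      tensor_superCommutative.odd_mul_odd (isHomog_single (isHomog_b _ _) l)
        (isHomog_single (isHomog_a _ _) k), mul_neg, ← mul_assoc, ← single_mul, huα, single_zero,
      zero_mul, neg_zero]
  have hkill' : (single k u : GradedTensorPower s (HPower g n)) * single l v *
      (single l α - single k α) = 0 := by rw [← neg_sub, mul_neg, hkill, neg_zero]
  have hs0 : 0 < s := by omega
  by_cases hk : (k : ℕ) = 0
  · obtain rfl : k = ⟨0, hs0⟩ := Fin.ext hk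
    obtain ⟨L, hp, -⟩ := exists_factors_perm_diff_a hs hg1 hn (k := l)
      fun h => hkl (Fin.ext h.symm)
    refine tensor_superCommutative.mul_prod_eq_zero hodd hp (z := diff α l) ?_ hkill
    rw [sub_self]; exact zero_mem _
  obtain ⟨L, hp, hL⟩ := exists_factors_perm_diff_a hs hg1 hn (k := k) hk
  refine tensor_superCommutative.mul_prod_eq_zero hodd hp (z := single l α - single k α) ?_ hkill'
  by_cases hl : (l : ℕ) = 0
  · rw [diff, show l = ⟨0, hs0⟩ from Fin.ext hl, sub_self]
    exact zero_mem _
  · rw [diff, sub_sub_sub_cancel_right]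
    exact Submodule.subset_span (hL l hl hkl.symm)

/-- The position of `ω_1` is immaterial, because the differences of `a_1(1)` and of `b_1(1)` in two
positions kill the product of the factors. -/
lemma single_omega_mul_factors_prod (hs : 2 ≤ s) (hg : 1 ≤ g) (hn : 1 ≤ n) (l : Fin s) :
    single l (omega (⟨0, hn⟩ : Fin n) : HPower g n) * (factors hs hg hn).prod =
      single (⟨0, by omega⟩ : Fin s) (omega (⟨0, hn⟩ : Fin n)) * (factors hs hg hn).prod := by
  have hs0 : 0 < s := by omega
  by_cases hl : (l : ℕ) = 0
  · rw [show l = ⟨0, hs0⟩ from Fin.ext hl]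
  set α := a (⟨0, hn⟩ : Fin n) (⟨0, hg⟩ : Fin g) with hα
  set β := b (⟨0, hn⟩ : Fin n) (⟨0, hg⟩ : Fin g) with hβ
  set Q := (factors hs hg hn).prod
  have hodd := isHomog_of_mem_factors hs hg hn
  have hω : (omega (⟨0, hn⟩ : Fin n) : HPower g n) = α * β := by
    rw [hα, hβ, a_mul_b, if_pos rfl]
  have h1 : (single l α : GradedTensorPower s (HPower g n)) * Q = single ⟨0, hs0⟩ α * Q := by
    have := tensor_superCommutative.mul_prod_of_mem_span hodd
      (Submodule.subset_span (diff_x_mem_factors hs hg hn ⟨0, hn⟩ hl))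
    rw [x_first, diff, sub_mul, sub_eq_zero] at this
    exact this.symm
  have h2 : (single l β : GradedTensorPower s (HPower g n)) * Q = single ⟨0, hs0⟩ β * Q := by
    have := tensor_superCommutative.mul_prod_of_mem_span hodd
      (Submodule.subset_span (diff_y_first_mem_factors hs hg hn hl))
    rw [y_first, diff, sub_mul, sub_eq_zero] at this
    exact this.symm
  have hab : ∀ k m : Fin s, (single k α : GradedTensorPower s (HPower g n)) * single m β =
      -(single m β * single k α) := fun k m =>
    tensor_superCommutative.odd_mul_odd (isHomog_single (isHomog_a _ _) k)
      (isHomog_single (isHomog_b _ _) m)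
  rw [hω, single_mul, single_mul, mul_assoc, h2, ← mul_assoc, hab, neg_mul, mul_assoc, h1,
    ← mul_assoc, ← neg_mul, ← hab]

end Factors

section Conclusion

variable {g n s : ℕ}

/-- Of the four terms of `c d`, only those with both classes in the same position contribute; there
are two of them if `s = 2`, and one otherwise. -/
lemma c_mul_d_mul_factors_prod (hs : 2 ≤ s) (hg : 2 ≤ g) (hn : 1 ≤ n) :
    ∃ r : ℚ, r ≠ 0 ∧ c hs hg hn * d hs hg hn * (factors hs (one_le_two.trans hg) hn).prod =
      r • (single (⟨0, by omega⟩ : Fin s) (omega (⟨0, hn⟩ : Fin n) : HPower g n) *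
        (factors hs (one_le_two.trans hg) hn).prod) := by
  have hs0 : 0 < s := by omega
  set Q := (factors hs (one_le_two.trans hg) hn).prod with hQ
  have hsame : ∀ l : Fin s, (single l (a (⟨0, hn⟩ : Fin n) (⟨1, hg⟩ : Fin g)) :
      GradedTensorPower s (HPower g n)) * single l (b (⟨0, hn⟩ : Fin n) (⟨1, hg⟩ : Fin g)) * Q =
      single (⟨0, hs0⟩ : Fin s) (omega (⟨0, hn⟩ : Fin n)) * Q := fun l => by
    rw [← single_mul, a_mul_b, if_pos rfl, hQ, single_omega_mul_factors_prod]
  have hne : ∀ {k l : Fin s}, (k : ℕ) ≠ l →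
      (single k (a (⟨0, hn⟩ : Fin n) (⟨1, hg⟩ : Fin g)) :
        GradedTensorPower s (HPower g n)) * single l (b (⟨0, hn⟩ : Fin n) (⟨1, hg⟩ : Fin g)) * Q =
      0 := fun h => single_a_mul_single_b_mul_factors_prod hs hg hn fun h' => h (by rw [h'])
  unfold c d
  split_ifs with h
  · refine ⟨1, one_ne_zero, ?_⟩
    rw [diff, diff, sub_mul, mul_sub, mul_sub, sub_mul, sub_mul, sub_mul, hsame,
      hne (by simp), hne (by simp), hne (by simp)]
    simp
  · refine ⟨2, two_ne_zero, ?_⟩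
    rw [diff, diff, sub_mul, mul_sub, mul_sub, sub_mul, sub_mul, sub_mul, hsame, hsame,
      hne (by simp), hne (by simp)]
    rw [two_smul]
    abel

lemma isHomog_c (hs : 2 ≤ s) (hg : 2 ≤ g) (hn : 1 ≤ n) : IsHomog 1 (c (n := n) hs hg hn) :=
  isHomog_diff (isHomog_a _ _) _

lemma isHomog_d (hs : 2 ≤ s) (hg : 2 ≤ g) (hn : 1 ≤ n) : IsHomog 1 (d (n := n) hs hg hn) := by
  unfold d
  split_ifs <;> exact isHomog_diff (isHomog_b _ _) _

/-! ### Non-vanishing and the count of factors -/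

lemma isHomog_annihilator (hg : 1 ≤ g) :
    IsHomog (∑ l : Fin s, (annihilatorList s n hg l).length) (annihilator s n hg) :=
  isHomog_tprod fun l => isHomog_list_prod (isHomog_of_mem_annihilatorList hg l)

theorem imageInE_prodY1_mul_prodXY_ne_zero (hs : 2 ≤ s) (hg : 1 ≤ g) (hn : 1 ≤ n) :
    imageInE g n s (prodY1 s hg hn * prodXY hs n hg) ≠ 0 := by
  intro h
  have h0 := annihilator_mul_eq_zero hg h
  rw [← factors_prod] at h0
  exact single_mul_factors_prod_ne_zero hs hg hn (by rw [h0, mul_zero])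

lemma isHomog_c_mul_d (hs : 2 ≤ s) (hg : 2 ≤ g) (hn : 1 ≤ n) :
    IsHomog 2 (c (n := n) hs hg hn * d hs hg hn) := by
  have h := (isHomog_c hs hg hn).mul (isHomog_d hs hg hn)
  exact h

theorem imageInE_c_mul_d_mul_ne_zero (hs : 2 ≤ s) (hg : 2 ≤ g) (hn : 1 ≤ n) :
    imageInE g n s (c hs hg hn * d hs hg hn * (prodY1 s (one_le_two.trans hg) hn *
      prodXY hs n (one_le_two.trans hg))) ≠ 0 := by
  intro h
  obtain ⟨r, hr, hr'⟩ := c_mul_d_mul_factors_prod hs hg hn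
  rw [factors_prod, ← mul_assoc, tensor_superCommutative.even_mul (isHomog_c_mul_d hs hg hn)
    (isHomog_annihilator _), mul_assoc, annihilator_mul_eq_zero _ h, ← factors_prod] at hr'
  exact (smul_ne_zero hr (single_mul_factors_prod_ne_zero hs _ hn)) hr'.symm

/-- Products of zero-divisors `δ_l(u)` are mapped to products of zero-divisors. -/
lemma isProdOfZeroDivisors_imageInE {L : List (GradedTensorPower s (HPower g n))}
    (hL : ∀ z ∈ L, ∃ u l, z = diff u l) :
    IsProdOfZeroDivisors L.length (imageInE g n s L.prod) := by
  refine ⟨L.map (imageInE g n s), List.length_map _, fun z hz => ?_, (map_list_prod _ _).symm⟩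
  obtain ⟨w, hw, rfl⟩ := List.mem_map.mp hz
  obtain ⟨u, l, rfl⟩ := hL w hw
  have h : imageInE g n s (diff u l) = diff (toEInfty g n u) l := map_diff _ _ u l
  exact h ▸ isZeroDivisor_diff _ _

lemma exists_eq_diff_of_mem (hs : 2 ≤ s) (hg : 1 ≤ g) (hn : 1 ≤ n) :
    ∀ z ∈ prodY1List s hg hn ++ prodXYList hs n hg, ∃ u l, z = diff u l := by
  intro z hz
  simp only [prodY1List, prodXYList, List.mem_append, List.mem_flatMap, List.mem_map,
    List.mem_singleton] at hz
  rcases hz with ⟨l, -, rfl⟩ | ⟨i, -, ⟨l, -, rfl⟩ | rfl⟩ <;> exact ⟨_, _, rfl⟩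

lemma length_prodY1List_append (hs : 2 ≤ s) (hg : 1 ≤ g) (hn : 1 ≤ n) :
    (prodY1List s hg hn ++ prodXYList hs n hg).length + 2 = s * (n + 1) := by
  rw [List.length_append, length_prodY1List, length_prodXYList, mul_add, mul_comm n s]
  omega

lemma isProdOfZeroDivisors_prodY1_mul_prodXY (hs : 2 ≤ s) (hg : 1 ≤ g) (hn : 1 ≤ n) :
    IsProdOfZeroDivisors (s * (n + 1) - 2) (imageInE g n s (prodY1 s hg hn * prodXY hs n hg)) := by
  have := isProdOfZeroDivisors_imageInE (exists_eq_diff_of_mem hs hg hn)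
  rwa [List.prod_append, prodY1List_prod, prodXYList_prod,
    Nat.eq_sub_of_add_eq (length_prodY1List_append hs hg hn)] at this

lemma isProdOfZeroDivisors_c_mul_d_mul (hs : 2 ≤ s) (hg : 2 ≤ g) (hn : 1 ≤ n) :
    IsProdOfZeroDivisors (s * (n + 1)) (imageInE g n s (c hs hg hn * d hs hg hn *
      (prodY1 s (one_le_two.trans hg) hn * prodXY hs n (one_le_two.trans hg)))) := by
  have hg1 : 1 ≤ g := one_le_two.trans hg
  have := isProdOfZeroDivisors_imageInE (L := c hs hg hn :: d hs hg hn ::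
    (prodY1List s hg1 hn ++ prodXYList hs n hg1)) (fun z hz => by
      rw [List.mem_cons, List.mem_cons] at hz
      rcases hz with rfl | rfl | hz
      · exact ⟨_, _, rfl⟩
      · unfold d
        split_ifs <;> exact ⟨_, _, rfl⟩
      · exact exists_eq_diff_of_mem hs hg1 hn z hz)
  rwa [List.prod_cons, List.prod_cons, List.prod_append, prodY1List_prod, prodXYList_prod,
    ← mul_assoc, List.length_cons, List.length_cons, add_assoc,
    length_prodY1List_append hs hg1 hn] at this

end Conclusion

end SurfaceConf

end

theorem mainTheorem2 (s n : ℕ) (hs : 2 ≤ s) (hn : 1 ≤ n) :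
    (SurfaceConf.IsProdOfZeroDivisors (s * (n + 1) - 2)
        (SurfaceConf.imageInE 1 n s
          (SurfaceConf.prodY1 s le_rfl hn * SurfaceConf.prodXY hs n le_rfl)) ∧
      SurfaceConf.imageInE 1 n s
        (SurfaceConf.prodY1 s le_rfl hn * SurfaceConf.prodXY hs n le_rfl) ≠ 0) ∧
    (∀ (g : ℕ) (hg : 2 ≤ g),
      SurfaceConf.IsProdOfZeroDivisors (s * (n + 1))
        (SurfaceConf.imageInE g n s
          (SurfaceConf.c hs hg hn * SurfaceConf.d hs hg hn *
            (SurfaceConf.prodY1 s (one_le_two.trans hg) hn *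
              SurfaceConf.prodXY hs n (one_le_two.trans hg)))) ∧
      SurfaceConf.imageInE g n s
        (SurfaceConf.c hs hg hn * SurfaceConf.d hs hg hn *
          (SurfaceConf.prodY1 s (one_le_two.trans hg) hn *
            SurfaceConf.prodXY hs n (one_le_two.trans hg))) ≠ 0) := by
  refine ⟨⟨?_, ?_⟩, fun g hg => ⟨?_, ?_⟩⟩
  · exact SurfaceConf.isProdOfZeroDivisors_prodY1_mul_prodXY hs le_rfl hn
  · exact SurfaceConf.imageInE_prodY1_mul_prodXY_ne_zero hs le_rfl hn
  · exact SurfaceConf.isProdOfZeroDivisors_c_mul_d_mul hs hg hn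
  · exact SurfaceConf.imageInE_c_mul_d_mul_ne_zero hs hg hn
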